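/- Let $T$ be a finite set of targets and $D$ a finite set of depots, let $V=T\cup D$ (disjoint union), and let $E$ be the set of unordered pairs of distinct elements of $V$ at least one of which is a target. Let $C_1,\dots,C_m$ be a partition of $T$ into non-empty clusters. For $A\subseteq V$ let $\gamma(A)$ be the set of edges with both ends in $A$ and $\delta(A)$ the set of edges with exactly one end in $A$; for disjoint $A,B\subseteq V$ let $(A:B)$ be the set of edges with one end in $A$ and the other in $B$; and for $F\subseteq E$ and $x\in\mathbb{R}^E$ put $x(F)=\sum_{e\in F}x_e$, with $x(A:B)$ short for $x((A:B))$. A pair $(x,y)\in\mathbb{R}^{E}\times\mathbb{R}^{T}$ is called *feasible* if 1. $x(\delta(\{i\}))=2y_i$ for all $i\in T$; 2. $\sum_{i\in C_h}y_i\ge 1$ for $h=1,\dots,m$; 3. $x(\delta(S))\ge 2y_i$ for all $S\subseteq T$ and $i\in S$; 4. $x(D':\{j\})+3x_{jk}+x(\{k\}:D\setminus D')\le 2(y_j+y_k)$ for all distinct $j,k\in T$ and all $D'\subsetneq D$; 5. $x(D':\{j\})+2x(\gamma(S\cup\{j,k\}))+x(\{k\}:D\setminus D')\le \sum_{v\in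 S}2y_v+2(y_j+y_k)-y_i$ for all distinct $j,k\in T$, all $S\subseteq T\setminus\{j,k\}$ with $S\ne\emptyset$, all $i\in S$ and all $D'\subsetneq D$; 6. $x_e\in\{0,1\}$ for $e\in\gamma(T)$, $x_e\in\{0,1,2\}$ for $e\in(D:T)$, and $y_i\in\{0,1\}$ for $i\in T$. Let $P\subset\mathbb{R}^{E}\times\mathbb{R}^{T}$ be the convex hull of the feasible pairs. Let $j,k\in T$ be distinct, let $\emptyset\neq D'\subsetneq D$, let $S\subseteq T\setminus\{j,k\}$ and $i\in S$. Put $\bar S=S\cup\{j,k\}$ and $\mu(S)=|\{h: C_h\subseteq S\}|$. Define $\bar\beta_v=0$ for $v\in T\setminus\bar S$, $\bar\beta_v=2$ for $v\in\bar S\setminus\{i\}$, and $\bar\beta_i=1$ if $\mu(S)=0$, $\bar\beta_i=2$ if $\mu(S)\ne 0$. Then the generalized path elimination constraint $$x(D':\{j\})+2x(\gamma(\bar S))+x(\{k\}:D\setminus D')+\sum_{v\in T}\bar\beta_v(1-y_v)\le 2|S|+3$$ is valid for $P$ (it holds at every point of $P$) and defines a facet of $P$ (the set of points of $P$ at which it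 holds with equality is non-empty and has affine dimension $\dim P-1$). Moreover, its validity does not depend on having imposed 4 and 5: it holds at every $(x,y)$ that satisfies 1, 2, 3 and 6 and for which there is no path $d_1,t_1,\dots,t_p,d_2$ with $p\ge 2$, distinct targets $t_1,\dots,t_p$ and distinct depots $d_1,d_2$, all of whose edges $e$ have $x_e\neq 0$. -/

import Mathlib

namespace GMDTSP

noncomputable section

/-- The graph `G = (V, E)` with `V = T ∪ D` (disjoint): two distinct vertices are adjacent
if and only if at least one of them is a target. -/
def graph (T D : Type*) : SimpleGraph (T ⊕ D) where
  Adj u v := u ≠ v ∧ (u.isLeft ∨ v.isLeft)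
  symm := ⟨fun _ _ h => ⟨h.1.symm, h.2.symm⟩⟩
  loopless := ⟨fun _ h => h.1 rfl⟩

/-- The edge set `E`, as a type. -/
abbrev Edge (T D : Type*) : Type _ := (graph T D).edgeSet

open Classical in
instance instFintypeEdge (T D : Type*) [Fintype T] [Fintype D] : Fintype (Edge T D) :=
  inferInstanceAs (Fintype {e : Sym2 (T ⊕ D) // e ∈ (graph T D).edgeSet})

/-- The space `ℝ^{|E| + |T|}` of pairs `(x, y)`. -/
abbrev Point (T D : Type*) : Type _ := (Edge T D → ℝ) × (T → ℝ)

section Notation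

variable {T D : Type*} [Fintype T] [Fintype D]

/-- A set of targets, as a set of vertices. -/
def tgt (S : Finset T) : Finset (T ⊕ D) := S.map Function.Embedding.inl

/-- A set of depots, as a set of vertices. -/
def dep (A : Finset D) : Finset (T ⊕ D) := A.map Function.Embedding.inr

open Classical in
/-- `γ(S)`: the edges with both ends in `S`. -/
def gamma (S : Finset (T ⊕ D)) : Finset (Edge T D) :=
  Finset.univ.filter fun e => ∀ v ∈ e.1, v ∈ S

open Classical in
/-- `δ(S)`: the edges with one end in `S` and the other end outside `S`. -/
def delta (S : Finset (T ⊕ D)) : Finset (Edge T D) :=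
  Finset.univ.filter fun e => ∃ u ∈ S, ∃ v, v ∉ S ∧ e.1 = s(u, v)

open Classical in
/-- `(A : B)`: the edges with one end in `A` and the other end in `B`. -/
def between (A B : Finset (T ⊕ D)) : Finset (Edge T D) :=
  Finset.univ.filter fun e => ∃ a ∈ A, ∃ b ∈ B, e.1 = s(a, b)

/-- `x(F)`: the sum of `x` over a set `F` of edges. -/
def total (x : Edge T D → ℝ) (F : Finset (Edge T D)) : ℝ := ∑ e ∈ F, x e

/-- The graph on the targets that joins `a` and `b` when the edge `(a, b)` is used by `x`. -/
def targetSupport (x : Edge T D → ℝ) : SimpleGraph T :=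
  SimpleGraph.fromRel fun a b => total x (between (tgt {a}) (tgt {b})) ≠ 0

end Notation

section Feasible

variable {T D : Type*} [Fintype T] [Fintype D] [DecidableEq T] [DecidableEq D]

/-- Degree, cluster, sub-tour elimination and integrality constraints.
The clusters are the parts of the partition `C` of the set of targets. -/
structure IsRelaxedSolution (C : Finpartition (Finset.univ : Finset T)) (p : Point T D) :
    Prop where
  degree : ∀ i : T, total p.1 (delta (tgt {i})) = 2 * p.2 i
  cluster : ∀ K ∈ C.parts, 1 ≤ ∑ i ∈ K, p.2 i
  subtour : ∀ S : Finset T, ∀ i ∈ S, 2 * p.2 i ≤ total p.1 (delta (tgt S))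
  integral_target : ∀ e ∈ gamma (tgt (D := D) (Finset.univ : Finset T)), p.1 e = 0 ∨ p.1 e = 1
  integral_depot : ∀ e ∈ between (dep (Finset.univ : Finset D)) (tgt (Finset.univ : Finset T)),
    p.1 e = 0 ∨ p.1 e = 1 ∨ p.1 e = 2
  integral_visit : ∀ i : T, p.2 i = 0 ∨ p.2 i = 1

/-- The feasible solutions of the integer program. -/
structure IsFeasible (C : Finpartition (Finset.univ : Finset T)) (p : Point T D) : Prop
    extends IsRelaxedSolution C p where
  path_two : ∀ j k : T, j ≠ k → ∀ D' : Finset D, D' ⊂ Finset.univ →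
    total p.1 (between (dep D') (tgt {j})) + 3 * total p.1 (between (tgt {j}) (tgt {k}))
        + total p.1 (between (tgt {k}) (dep D'ᶜ))
      ≤ 2 * (p.2 j + p.2 k)
  path_many : ∀ j k : T, j ≠ k → ∀ S : Finset T, j ∉ S → k ∉ S → ∀ i ∈ S,
    ∀ D' : Finset D, D' ⊂ Finset.univ →
    total p.1 (between (dep D') (tgt {j})) + 2 * total p.1 (gamma (tgt (S ∪ {j, k})))
        + total p.1 (between (tgt {k}) (dep D'ᶜ))
      ≤ ∑ v ∈ S, 2 * p.2 v + 2 * (p.2 j + p.2 k) - p.2 i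

/-- The same notion with the path elimination inequalities replaced by their meaning:
no path `d₁, t₁, …, tₚ, d₂` with `p ≥ 2` and distinct depots `d₁`, `d₂` is used. -/
structure IsRouting (C : Finpartition (Finset.univ : Finset T)) (p : Point T D) : Prop
    extends IsRelaxedSolution C p where
  no_path : ∀ d₁ d₂ : D, d₁ ≠ d₂ → ∀ a b : T, a ≠ b → (targetSupport p.1).Reachable a b →
    total p.1 (between (dep {d₁}) (tgt {a})) ≠ 0 →
    total p.1 (between (dep {d₂}) (tgt {b})) = 0

/-- The polytope `P`: the convex hull of the feasible solutions. -/
def polytope (D : Type*) [Fintype D] [DecidableEq D]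
    (C : Finpartition (Finset.univ : Finset T)) : Set (Point T D) :=
  convexHull ℝ {p | IsFeasible C p}

/-- `μ(S)`: the number of clusters that are contained in `S`. -/
def mu (C : Finpartition (Finset.univ : Finset T)) (S : Finset T) : ℕ :=
  (C.parts.filter fun K => K ⊆ S).card

/-- The coefficients `β̄_v`. -/
def beta (C : Finpartition (Finset.univ : Finset T)) (S : Finset T) (i j k : T) (v : T) : ℝ :=
  if v ∉ S ∪ {j, k} then 0
  else if v ≠ i then 2
  else if mu C S = 0 then 1
  else 2

/-- The left-hand side of the generalized path elimination constraint. -/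
def pathLHS (C : Finpartition (Finset.univ : Finset T)) (D' : Finset D) (S : Finset T)
    (i j k : T) (p : Point T D) : ℝ :=
  total p.1 (between (dep D') (tgt {j})) + 2 * total p.1 (gamma (tgt (S ∪ {j, k})))
    + total p.1 (between (tgt {k}) (dep D'ᶜ))
    + ∑ v, beta C S i j k v * (1 - p.2 v)

end Feasible

/-- The inequality `f ≤ c` is valid for `P`. -/
def IsValid {E : Type*} (P : Set E) (f : E → ℝ) (c : ℝ) : Prop := ∀ p ∈ P, f p ≤ c

/-- The inequality `f ≤ c` is facet-defining for `P`: it is valid, and the face that it induces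
is non-empty and has affine dimension `dim P - 1`. -/
def IsFacetDefining {E : Type*} [AddCommGroup E] [Module ℝ E] (P : Set E) (f : E → ℝ) (c : ℝ) :
    Prop :=
  IsValid P f c ∧ {p ∈ P | f p = c}.Nonempty ∧
    Module.finrank ℝ (vectorSpan ℝ {p ∈ P | f p = c}) + 1 = Module.finrank ℝ (vectorSpan ℝ P)

end

end GMDTSP

set_option linter.unusedSectionVars false

namespace GMDTSP

noncomputable section

/-! ### Edge sets, cuts and the degree sum. -/

section Cuts

variable {T D : Type*} [Fintype T] [Fintype D]

/-! Write `slack` for the cut of S ∪ {j, k} minus the depot edges x(D':{j}) and x({k}:D∖D'). The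
degree equations turn 2x(γ) into a degree sum minus a cut, so the constraint says slack + [μ(S) =
0](1 - y_i) ≥ 1 (`pathLHS_eq`). The slack is never negative, and constraint 5 makes it at least 1
once any target of S is visited. If μ(S) ≠ 0, a cluster inside S forces such a visit. If μ(S) = 0,
either i is visited or 1 - y_i supplies the missing unit.

Constraints 4 and 5 follow from the absence of paths between distinct depots
(`IsRouting.isFeasible`). If a visited i had slack 0, the component of i within S ∪ {j, k} could be
left only through depot edges at j and k. Each of these carries less than two units, and they cannot
both be used, so a sub-tour constraint fails (`IsRouting.add_one_le_delta`).

For the facet, let G be a linear functional constant on the face. Subtracting multiples of the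
degree equations and of the path inequality gives a functional vanishing on every edge at a depot d₀
∈ D' and on one edge e₀j with e₀ ∉ D'. Comparing explicit tours on the face then kills all edge
coefficients (`IsFaceFunctional.edge_eq_zero`) and the coefficient of y_v unless {v} is a cluster
(`IsFaceFunctional.visit_eq_zero`). In the exceptional case y_v = 1 throughout P. Hence G vanishes
on every direction of P parallel to the hyperplane, and by duality all such directions belong to the
face (`mem_vectorSpan_face`). The face is non-empty and proper, so its dimension is dim P - 1. -/

@[simp] theorem inl_mem_tgt {S : Finset T} {t : T} : (Sum.inl t : T ⊕ D) ∈ tgt S ↔ t ∈ S := by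
  simp [tgt]

@[simp] theorem inr_notMem_tgt {S : Finset T} {d : D} : (Sum.inr d : T ⊕ D) ∉ tgt S := by
  simp [tgt]

@[simp] theorem inr_mem_dep {A : Finset D} {d : D} : (Sum.inr d : T ⊕ D) ∈ dep A ↔ d ∈ A := by
  simp [dep]

@[simp] theorem inl_notMem_dep {A : Finset D} {t : T} : (Sum.inl t : T ⊕ D) ∉ dep A := by
  simp [dep]

@[simp] theorem adj_inl_inl {a b : T} : (graph T D).Adj (.inl a) (.inl b) ↔ a ≠ b := by
  simp [graph]

@[simp] theorem adj_inl_inr {a : T} {d : D} : (graph T D).Adj (.inl a) (.inr d) := by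
  simp [graph]

@[simp] theorem adj_inr_inl {a : T} {d : D} : (graph T D).Adj (.inr d) (.inl a) := by
  simp [graph]

@[simp] theorem not_adj_inr_inr {d e : D} : ¬ (graph T D).Adj (.inr d) (.inr e) := by
  simp [graph]

theorem mem_delta {S : Finset (T ⊕ D)} {u v : T ⊕ D} {h : s(u, v) ∈ (graph T D).edgeSet} :
    (⟨s(u, v), h⟩ : Edge T D) ∈ delta S ↔ (u ∈ S ∧ v ∉ S) ∨ (v ∈ S ∧ u ∉ S) := by
  simp only [delta, Finset.mem_filter, Finset.mem_univ, true_and, Sym2.eq_iff]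
  constructor
  · rintro ⟨a, ha, b, hb, (⟨rfl, rfl⟩ | ⟨rfl, rfl⟩)⟩ <;> simp [*]
  · rintro (⟨hu, hv⟩ | ⟨hv, hu⟩)
    · exact ⟨u, hu, v, hv, by simp⟩
    · exact ⟨v, hv, u, hu, by simp⟩

theorem mem_gamma {S : Finset (T ⊕ D)} {u v : T ⊕ D} {h : s(u, v) ∈ (graph T D).edgeSet} :
    (⟨s(u, v), h⟩ : Edge T D) ∈ gamma S ↔ u ∈ S ∧ v ∈ S := by
  simp [gamma]

theorem mem_between {A B : Finset (T ⊕ D)} {u v : T ⊕ D}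
    {h : s(u, v) ∈ (graph T D).edgeSet} :
    (⟨s(u, v), h⟩ : Edge T D) ∈ between A B ↔ (u ∈ A ∧ v ∈ B) ∨ (v ∈ A ∧ u ∈ B) := by
  simp only [between, Finset.mem_filter, Finset.mem_univ, true_and, Sym2.eq_iff]
  constructor
  · rintro ⟨a, ha, b, hb, (⟨rfl, rfl⟩ | ⟨rfl, rfl⟩)⟩ <;> simp [*]
  · rintro (⟨hu, hv⟩ | ⟨hv, hu⟩)
    · exact ⟨u, hu, v, hv, by simp⟩
    · exact ⟨v, hv, u, hu, by simp⟩

theorem between_comm (A B : Finset (T ⊕ D)) : between A B = between B A := by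
  ext ⟨e, he⟩
  induction e with | h u v => simp only [mem_between]; tauto

/-- Every edge joins two targets or a depot and a target. -/
theorem edge_cases {motive : Edge T D → Prop}
    (target : ∀ (a b : T) (h : s(.inl a, .inl b) ∈ (graph T D).edgeSet),
      motive ⟨s(.inl a, .inl b), h⟩)
    (depot : ∀ (d : D) (a : T) (h : s(.inr d, .inl a) ∈ (graph T D).edgeSet),
      motive ⟨s(.inr d, .inl a), h⟩) (e : Edge T D) : motive e := by
  obtain ⟨e, he⟩ := e
  induction e with
  | h u v =>
    rcases u with a | d <;> rcases v with b | d'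
    · exact target a b he
    · have h : s((.inl a : T ⊕ D), .inr d') = s(.inr d', .inl a) := Sym2.eq_swap
      have := depot d' a (h ▸ he)
      simpa only [h] using this
    · exact depot d b he
    · simp at he

theorem total_eq_sum_univ (x : Edge T D → ℝ) (F : Finset (Edge T D)) [DecidablePred (· ∈ F)] :
    total x F = ∑ e, if e ∈ F then x e else 0 := by
  rw [total, ← Finset.sum_filter]
  exact Finset.sum_congr (by ext; simp) fun _ _ => rfl

theorem total_mono {x : Edge T D → ℝ} (hx : ∀ e, 0 ≤ x e) {F F' : Finset (Edge T D)}
    (h : ∀ e ∈ F, x e ≠ 0 → e ∈ F') : total x F ≤ total x F' := by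
  classical
  rw [total, ← Finset.sum_filter_ne_zero]
  refine Finset.sum_le_sum_of_subset_of_nonneg (fun e he => ?_) fun e _ _ => hx e
  rw [Finset.mem_filter] at he
  exact h e he.1 he.2

theorem total_add_le {x : Edge T D → ℝ} (hx : ∀ e, 0 ≤ x e) {A B F : Finset (Edge T D)}
    (hA : A ⊆ F) (hB : B ⊆ F) (hAB : Disjoint A B) : total x A + total x B ≤ total x F := by
  classical
  rw [total, total, ← Finset.sum_union hAB]
  exact Finset.sum_le_sum_of_subset_of_nonneg (Finset.union_subset hA hB) fun e _ _ => hx e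

theorem total_nonneg {x : Edge T D → ℝ} (hx : ∀ e, 0 ≤ x e) (F : Finset (Edge T D)) :
    0 ≤ total x F := Finset.sum_nonneg fun e _ => hx e

theorem exists_ne_zero_of_total_ne_zero {x : Edge T D → ℝ} {F : Finset (Edge T D)}
    (h : total x F ≠ 0) : ∃ e ∈ F, x e ≠ 0 := Finset.exists_ne_zero_of_sum_ne_zero h

theorem total_between_targets (x : Edge T D → ℝ) {a b : T}
    (h : s(.inl a, .inl b) ∈ (graph T D).edgeSet) :
    total x (between (tgt {a}) (tgt {b})) = x ⟨s(.inl a, .inl b), h⟩ := by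
  rw [total, Finset.sum_eq_single_of_mem]
  · simp [mem_between]
  · intro e he hne
    induction e using edge_cases with
    | target a' b' h' =>
      simp only [mem_between, inl_mem_tgt, Finset.mem_singleton] at he
      exfalso; apply hne
      rcases he with ⟨rfl, rfl⟩ | ⟨rfl, rfl⟩ <;> simp [Sym2.eq_swap]
    | depot d a' h' => simp [mem_between] at he

theorem total_between_depot (x : Edge T D → ℝ) {d : D} {a : T}
    (h : s(.inr d, .inl a) ∈ (graph T D).edgeSet) :
    total x (between (dep {d}) (tgt {a})) = x ⟨s(.inr d, .inl a), h⟩ := by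
  rw [total, Finset.sum_eq_single_of_mem]
  · simp [mem_between]
  · intro e he hne
    induction e using edge_cases with
    | target a' b' h' => simp [mem_between] at he
    | depot d' a' h' =>
      simp only [mem_between, inl_mem_tgt, inr_mem_dep, Finset.mem_singleton] at he
      exfalso; apply hne
      rcases he with ⟨rfl, rfl⟩ | ⟨h, _⟩
      · rfl
      · simp at h

/-- The sum of the degrees over a set of targets counts its cut once and its inner edges twice. -/
theorem sum_total_delta (x : Edge T D → ℝ) (S : Finset T) :
    ∑ v ∈ S, total x (delta (tgt {v})) = total x (delta (tgt S)) + 2 * total x (gamma (tgt S)) := by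
  classical
  simp only [total_eq_sum_univ, Finset.mul_sum]
  rw [Finset.sum_comm, ← Finset.sum_add_distrib]
  refine Finset.sum_congr rfl fun e _ => ?_
  induction e using edge_cases with
  | target a b h =>
    have hab : a ≠ b := by simpa using h
    have key : ∀ v ∈ S, (if (⟨s(.inl a, .inl b), h⟩ : Edge T D) ∈ delta (tgt {v})
        then x ⟨s(.inl a, .inl b), h⟩ else 0)
        = (if v = a then x ⟨s(.inl a, .inl b), h⟩ else 0)
          + if v = b then x ⟨s(.inl a, .inl b), h⟩ else 0 := by
      intro v _
      simp only [mem_delta, inl_mem_tgt, Finset.mem_singleton]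
      by_cases h1 : v = a
      · subst h1; simp [hab, hab.symm]
      · by_cases h2 : v = b
        · subst h2; simp [hab, hab.symm]
        · simp [h1, h2, Ne.symm h1, Ne.symm h2]
    rw [Finset.sum_congr rfl key, Finset.sum_add_distrib, Finset.sum_ite_eq', Finset.sum_ite_eq']
    simp only [mem_delta, mem_gamma, inl_mem_tgt]
    by_cases h1 : a ∈ S <;> by_cases h2 : b ∈ S <;> (simp [h1, h2]; try ring)
  | depot d a h =>
    have key : ∀ v ∈ S, (if (⟨s(.inr d, .inl a), h⟩ : Edge T D) ∈ delta (tgt {v})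
        then x ⟨s(.inr d, .inl a), h⟩ else 0)
        = if v = a then x ⟨s(.inr d, .inl a), h⟩ else 0 := by
      intro v _
      simp [mem_delta, eq_comm]
    rw [Finset.sum_congr rfl key, Finset.sum_ite_eq']
    simp [mem_delta, mem_gamma]

end Cuts

/-! ### Consequences of the degree, sub-tour and integrality constraints. -/

section Relaxed

variable {T D : Type*} [Fintype T] [Fintype D] [DecidableEq T] [DecidableEq D]
  {C : Finpartition (Finset.univ : Finset T)} {p : Point T D}

namespace IsRelaxedSolution

theorem exists_nat (hp : IsRelaxedSolution C p) (e : Edge T D) : ∃ n : ℕ, p.1 e = n := by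
  induction e using edge_cases with
  | target a b h =>
    rcases hp.integral_target ⟨_, h⟩ (by simp [mem_gamma]) with h | h
    · exact ⟨0, by simp [h]⟩
    · exact ⟨1, by simp [h]⟩
  | depot d a h =>
    rcases hp.integral_depot ⟨_, h⟩ (by simp [mem_between]) with h | h | h
    · exact ⟨0, by simp [h]⟩
    · exact ⟨1, by simp [h]⟩
    · exact ⟨2, by simp [h]⟩

theorem nonneg (hp : IsRelaxedSolution C p) (e : Edge T D) : 0 ≤ p.1 e := by
  obtain ⟨n, hn⟩ := hp.exists_nat e
  simp [hn]

theorem exists_nat_total (hp : IsRelaxedSolution C p) (F : Finset (Edge T D)) :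
    ∃ n : ℕ, total p.1 F = n := by
  choose f hf using hp.exists_nat
  exact ⟨∑ e ∈ F, f e, by simp [total, hf]⟩

theorem one_le_total (hp : IsRelaxedSolution C p) {F : Finset (Edge T D)}
    (h : total p.1 F ≠ 0) : 1 ≤ total p.1 F := by
  obtain ⟨n, hn⟩ := hp.exists_nat_total F
  rw [hn] at h ⊢
  have : n ≠ 0 := by simpa using h
  exact_mod_cast Nat.one_le_iff_ne_zero.2 this

/-- The two families of depot edges use complementary sets of depots, so they are disjoint parts of
the cut. For R = S ∪ {j, k} this is non-negativity of the slack. -/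
theorem le_delta (hp : IsRelaxedSolution C p) (D' : Finset D) {j k : T}
    {R : Finset T} (hj : j ∈ R) (hk : k ∈ R) :
    total p.1 (between (dep D') (tgt {j})) + total p.1 (between (tgt {k}) (dep D'ᶜ))
      ≤ total p.1 (delta (tgt R)) := by
  refine total_add_le hp.nonneg ?_ ?_ ?_
  · intro e he
    induction e using edge_cases with
    | target a b h => simp [mem_between] at he
    | depot d a h =>
      simp only [mem_between, mem_delta] at he ⊢
      simp at he ⊢; aesop
  · intro e he
    induction e using edge_cases with
    | target a b h => simp [mem_between] at he
    | depot d a h =>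
      simp only [mem_between, mem_delta] at he ⊢
      simp at he ⊢; aesop
  · rw [Finset.disjoint_left]
    intro e he he'
    induction e using edge_cases with
    | target a b h => simp [mem_between] at he
    | depot d a h =>
      simp only [mem_between] at he he'
      simp at he he'; aesop

/-- Inner edges are traded for the cut by summing the degree equations; this makes the path
inequalities into lower bounds on a cut. -/
theorem two_mul_gamma (hp : IsRelaxedSolution C p) (R : Finset T) :
    2 * total p.1 (gamma (tgt R)) = ∑ v ∈ R, 2 * p.2 v - total p.1 (delta (tgt R)) := by
  have h := sum_total_delta p.1 R
  simp only [hp.degree] at h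
  linarith

/-- A target with a used target neighbour has at most `2 y - 1` left for its depots. -/
theorem depot_add_target_le (hp : IsRelaxedSolution C p) (A : Finset D) {a b : T} (hab : a ≠ b) :
    total p.1 (between (dep A) (tgt {a})) + total p.1 (between (tgt {a}) (tgt {b}))
      ≤ 2 * p.2 a := by
  rw [← hp.degree]
  refine total_add_le hp.nonneg ?_ ?_ ?_
  · intro e he
    induction e using edge_cases with
    | target a b h => simp [mem_between] at he
    | depot d a h =>
      simp only [mem_between, mem_delta] at he ⊢
      simp at he ⊢; aesop
  · intro e he
    induction e using edge_cases with
    | target a b h =>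
      simp only [mem_between, mem_delta] at he ⊢
      simp at he ⊢; grind
    | depot d a h => simp [mem_between] at he
  · rw [Finset.disjoint_left]
    intro e he he'
    induction e using edge_cases with
    | target a b h => simp [mem_between] at he
    | depot d a h => simp [mem_between] at he'

theorem depot_le (hp : IsRelaxedSolution C p) (A : Finset D) (a : T) :
    total p.1 (between (dep A) (tgt {a})) ≤ 2 * p.2 a := by
  rw [← hp.degree]
  refine total_mono hp.nonneg fun e he _ => ?_
  induction e using edge_cases with
  | target a b h => simp [mem_between] at he
  | depot d a h =>
    simp only [mem_between, mem_delta] at he ⊢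
    simp at he ⊢; aesop

theorem visit_le_one (hp : IsRelaxedSolution C p) (a : T) : p.2 a ≤ 1 := by
  rcases hp.integral_visit a with h | h <;> simp [h]

end IsRelaxedSolution

theorem exists_depot_of_total_ne_zero {x : Edge T D → ℝ} {A : Finset D} {a : T}
    (h : total x (between (dep A) (tgt {a})) ≠ 0) :
    ∃ d ∈ A, total x (between (dep {d}) (tgt {a})) ≠ 0 := by
  obtain ⟨e, he, hx⟩ := exists_ne_zero_of_total_ne_zero h
  induction e using edge_cases with
  | target a b h => simp [mem_between] at he
  | depot d a' hd =>
    simp only [mem_between] at he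
    simp at he
    obtain ⟨hA, rfl⟩ := he
    exact ⟨d, hA, by rwa [total_between_depot x hd]⟩

theorem targetSupport_adj {x : Edge T D → ℝ} {a b : T} :
    (targetSupport x).Adj a b ↔ a ≠ b ∧ total x (between (tgt {a}) (tgt {b})) ≠ 0 := by
  rw [targetSupport, SimpleGraph.fromRel_adj, between_comm (tgt {b}) (tgt {a}), or_self]

/-! ### Path elimination from the absence of paths between depots. -/

namespace IsRouting

theorem separated (hp : IsRouting C p) {D' : Finset D} {j k : T} (hjk : j ≠ k)
    (h : (targetSupport p.1).Reachable j k) :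
    total p.1 (between (dep D') (tgt {j})) = 0 ∨ total p.1 (between (tgt {k}) (dep D'ᶜ)) = 0 := by
  by_contra! hne
  rw [between_comm (tgt {k})] at hne
  obtain ⟨d, hd, h1⟩ := exists_depot_of_total_ne_zero hne.1
  obtain ⟨e, he, h2⟩ := exists_depot_of_total_ne_zero hne.2
  refine h2 (hp.no_path d e ?_ j k hjk h h1)
  rintro rfl
  exact Finset.mem_compl.1 he hd

/-- A target reached from another target gets less than two units from the depots. -/
theorem depot_lt_two (hp : IsRouting C p) {i j : T} (hij : i ≠ j)
    (h : (targetSupport p.1).Reachable i j) (A : Finset D) :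
    total p.1 (between (dep A) (tgt {j})) < 2 := by
  obtain ⟨w⟩ := h.symm
  cases w with
  | nil => exact absurd rfl hij
  | @cons _ v _ hadj _ =>
    obtain ⟨hne, h0⟩ := targetSupport_adj.1 hadj
    have h1 := hp.depot_add_target_le A hne
    have h2 := hp.one_le_total h0
    have h3 := hp.visit_le_one j
    linarith

/-- Otherwise integrality gives slack 0, so the cut uses no edges besides those subtracted. The
targets connected to i then violate sub-tour elimination. -/
theorem add_one_le_delta (hp : IsRouting C p) {D' : Finset D} {S : Finset T} {i j k : T}
    (hjk : j ≠ k) (hj : j ∉ S) (hk : k ∉ S) (hi : i ∈ S) (hy : p.2 i = 1) :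
    total p.1 (between (dep D') (tgt {j})) + total p.1 (between (tgt {k}) (dep D'ᶜ)) + 1
      ≤ total p.1 (delta (tgt (S ∪ {j, k}))) := by
  classical
  have hij : i ≠ j := by rintro rfl; exact hj hi
  have hik : i ≠ k := by rintro rfl; exact hk hi
  have hle := hp.le_delta D' (j := j) (k := k) (R := S ∪ {j, k}) (by simp) (by simp)
  obtain ⟨n₁, e₁⟩ := hp.exists_nat_total (between (dep D') (tgt {j}))
  obtain ⟨n₂, e₂⟩ := hp.exists_nat_total (between (tgt {k}) (dep D'ᶜ))
  obtain ⟨n₃, e₃⟩ := hp.exists_nat_total (delta (tgt (S ∪ {j, k})))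
  by_contra hlt
  have heq : total p.1 (delta (tgt (S ∪ {j, k}))) =
      total p.1 (between (dep D') (tgt {j})) + total p.1 (between (tgt {k}) (dep D'ᶜ)) := by
    rw [e₁, e₂, e₃] at hle hlt ⊢
    norm_cast at hle hlt ⊢
    omega
  have hdisj : Disjoint (between (dep D') (tgt {j})) (between (tgt {k}) (dep D'ᶜ)) := by
    rw [Finset.disjoint_left]
    intro e he he'
    induction e using edge_cases with
    | target a b h => simp [mem_between] at he
    | depot d a h => simp [mem_between] at he he'; aesop
  -- Any further used edge of the cut would add a positive amount to an already exhausted total.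
  have hused : ∀ e ∈ delta (tgt (S ∪ {j, k})), p.1 e ≠ 0 →
      e ∈ between (dep D') (tgt {j}) ∪ between (tgt {k}) (dep D'ᶜ) := by
    intro e he hne
    by_contra hnot
    have hsub : insert e (between (dep D') (tgt {j}) ∪ between (tgt {k}) (dep D'ᶜ)) ⊆
        delta (tgt (S ∪ {j, k})) := by
      refine Finset.insert_subset he ?_
      intro e he
      induction e using edge_cases with
      | target a b h => simp [mem_between] at he
      | depot d a h =>
        simp only [Finset.mem_union, mem_between, mem_delta] at he ⊢
        simp at he ⊢; grind
    have h1 := Finset.sum_le_sum_of_subset_of_nonneg hsub fun e _ _ => hp.nonneg e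
    rw [Finset.sum_insert hnot, Finset.sum_union hdisj] at h1
    simp only [total] at heq
    have := lt_of_le_of_ne (hp.nonneg e) hne.symm
    linarith
  -- A is closed under used target edges inside S ∪ {j, k}, so every used edge leaving A also leaves
  -- S ∪ {j, k}. Reachability may pass through outside targets, which is harmless here.
  set A : Finset T := (S ∪ {j, k}).filter fun v => (targetSupport p.1).Reachable i v with hA
  have hiA : i ∈ A := by simp [hA, hi]
  have hcut := hp.subtour A i hiA
  have hbound : total p.1 (delta (tgt A)) ≤
      (if j ∈ A then total p.1 (between (dep D') (tgt {j})) else 0) +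
      (if k ∈ A then total p.1 (between (tgt {k}) (dep D'ᶜ)) else 0) := by
    have hsub : total p.1 (delta (tgt A)) ≤
        total p.1 ((if j ∈ A then between (dep D') (tgt {j}) else ∅) ∪
          (if k ∈ A then between (tgt {k}) (dep D'ᶜ) else ∅)) := by
      refine total_mono hp.nonneg fun e he hne => ?_
      have hout : e ∈ delta (tgt (S ∪ {j, k})) := by
        induction e using edge_cases with
        | target a b h =>
          have hab : a ≠ b := by simpa using h
          have hadj : p.1 ⟨_, h⟩ ≠ 0 → (targetSupport p.1).Adj a b := by
            intro h0
            rw [targetSupport_adj, total_between_targets p.1 h]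
            exact ⟨hab, h0⟩
          simp only [mem_delta, inl_mem_tgt, hA, Finset.mem_filter] at he ⊢
          have h1 := (hadj hne).reachable
          rcases he with ⟨⟨ha, hr⟩, hb⟩ | ⟨⟨hb, hr⟩, ha⟩
          · exact Or.inl ⟨ha, fun hb' => hb ⟨hb', hr.trans h1⟩⟩
          · exact Or.inr ⟨hb, fun ha' => ha ⟨ha', hr.trans h1.symm⟩⟩
        | depot d a h =>
          simp only [mem_delta, inl_mem_tgt, hA, Finset.mem_filter] at he ⊢
          simp at he ⊢; exact he.1
      have h2 := hused e hout hne
      induction e using edge_cases with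
      | target a b h => simp [mem_between] at h2
      | depot d a h =>
        have haA : a ∈ A := by simpa [mem_delta] using he
        rw [Finset.mem_union] at h2 ⊢
        rcases h2 with h2 | h2
        · left
          have : a = j := by simp [mem_between] at h2; exact h2.2
          rw [if_pos (this ▸ haA)]; exact h2
        · right
          have : a = k := by simp [mem_between] at h2; exact h2.1
          rw [if_pos (this ▸ haA)]; exact h2
    refine hsub.trans ?_
    have hun : ∀ F F' : Finset (Edge T D), total p.1 (F ∪ F') ≤ total p.1 F + total p.1 F' := by
      intro F F'
      have h := Finset.sum_union_inter (s₁ := F) (s₂ := F') (f := p.1)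
      have h' := total_nonneg hp.nonneg (F ∩ F')
      simp only [total] at h' ⊢
      linarith
    refine (hun _ _).trans (le_of_eq ?_)
    split_ifs <;> simp [total]
  rw [hy] at hcut
  have hj2 : j ∈ A → total p.1 (between (dep D') (tgt {j})) < 2 := fun h =>
    hp.depot_lt_two hij (Finset.mem_filter.1 h).2 D'
  have hk2 : k ∈ A → total p.1 (between (tgt {k}) (dep D'ᶜ)) < 2 := fun h => by
    rw [between_comm]; exact hp.depot_lt_two hik (Finset.mem_filter.1 h).2 _
  -- The cut of A must be at least 2. If both j and k lie in A, they are connected and `separated`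
  -- makes one term vanish; the remaining term is below 2 in every case.
  by_cases h1 : j ∈ A <;> by_cases h2 : k ∈ A <;> simp only [h1, h2, if_true, if_false] at hbound
  · have := hj2 h1
    have := hk2 h2
    rcases hp.separated (D' := D') hjk
      ((Finset.mem_filter.1 h1).2.symm.trans (Finset.mem_filter.1 h2).2) with h | h <;> linarith
  · have := hj2 h1; linarith
  · have := hk2 h2; linarith
  · linarith

/-- The path elimination inequalities hold as soon as no path joins two depots. -/
theorem isFeasible (hp : IsRouting C p) : IsFeasible C p where
  toIsRelaxedSolution := hp.toIsRelaxedSolution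
  path_two := by
    intro j k hjk D' _
    have hb := hp.depot_le D'ᶜ k
    have ha := hp.depot_le D' j
    rw [between_comm] at hb
    by_cases h0 : total p.1 (between (tgt {j}) (tgt (D := D) {k})) = 0
    · rw [h0]; linarith
    · have hadj : s(.inl j, .inl k) ∈ (graph T D).edgeSet := by simpa using hjk
      have h1 : total p.1 (between (tgt {j}) (tgt (D := D) {k})) = 1 := by
        rw [total_between_targets p.1 hadj] at h0 ⊢
        rcases hp.integral_target ⟨_, hadj⟩ (by simp [mem_gamma]) with h | h
        · exact absurd h h0
        · exact h
      have ha' := hp.depot_add_target_le D' hjk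
      have hb' := hp.depot_add_target_le D'ᶜ hjk.symm
      rw [between_comm (tgt {k}) (tgt {j})] at hb'
      rw [between_comm _ (tgt {k})] at hb'
      have := total_nonneg hp.nonneg (between (dep D') (tgt {j}))
      have := total_nonneg hp.nonneg (between (tgt {k}) (dep D'ᶜ))
      have hj : p.2 j = 1 := (hp.integral_visit j).resolve_left fun h => by rw [h] at ha'; linarith
      have hk : p.2 k = 1 := (hp.integral_visit k).resolve_left fun h => by rw [h] at hb'; linarith
      rw [hj] at ha' ⊢
      rw [hk] at hb' ⊢
      rcases hp.separated (D' := D') hjk (targetSupport_adj.2 ⟨hjk, h0⟩).reachable with h | h <;>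
        linarith
  path_many := by
    intro j k hjk S hj hk i hi D' _
    rw [hp.two_mul_gamma]
    have hsum : ∑ v ∈ S ∪ {j, k}, 2 * p.2 v = ∑ v ∈ S, 2 * p.2 v + 2 * (p.2 j + p.2 k) := by
      rw [Finset.sum_union (by simp [hj, hk]), Finset.sum_pair hjk]; ring
    rw [hsum]
    rcases hp.integral_visit i with hy | hy
    · have := hp.le_delta D' (j := j) (k := k) (R := S ∪ {j, k}) (by simp) (by simp)
      linarith
    · have := hp.add_one_le_delta (D' := D') hjk hj hk hi hy
      linarith

end IsRouting

/-! ### The generalized inequality as a bound on the slack. -/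

theorem sum_beta {S : Finset T} {i j k : T} (hjk : j ≠ k) (hj : j ∉ S) (hk : k ∉ S) (hi : i ∈ S)
    (y : T → ℝ) : ∑ v, beta C S i j k v * (1 - y v) =
      2 * ((S.card : ℝ) + 2) - (∑ v ∈ S ∪ {j, k}, 2 * y v)
        - if mu C S = 0 then 1 - y i else 0 := by
  have hcard : ((S ∪ {j, k}).card : ℝ) = S.card + 2 := by
    rw [Finset.card_union_of_disjoint (by simp [hj, hk]), Finset.card_pair hjk]; push_cast; ring
  have hterm : ∀ v, beta C S i j k v * (1 - y v) =
      (if v ∈ S ∪ {j, k} then 2 - 2 * y v else 0)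
        - if v = i then (if mu C S = 0 then 1 - y i else 0) else 0 := by
    intro v
    unfold beta
    by_cases hv : v = i
    · subst hv
      by_cases hm : mu C S = 0 <;> simp [hi, hm] <;> ring
    · by_cases h : v ∈ S ∪ {j, k}
      · simp only [h, hv, not_true, if_false, if_true, ne_eq, not_false_eq_true]; ring
      · simp only [h, hv, not_false_eq_true, if_true, if_false]; ring
  simp only [hterm]
  rw [Finset.sum_sub_distrib, Finset.sum_ite_eq' Finset.univ i, ← Finset.sum_filter]
  simp only [Finset.filter_mem_eq_inter, Finset.univ_inter, Finset.mem_univ, if_true]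
  rw [Finset.sum_sub_distrib, Finset.sum_const, nsmul_eq_mul, hcard]
  ring

/-- The left-hand side in terms of the cut of `S ∪ {j, k}`. -/
theorem pathLHS_eq (hp : IsRelaxedSolution C p) {D' : Finset D} {S : Finset T} {i j k : T}
    (hjk : j ≠ k) (hj : j ∉ S) (hk : k ∉ S) (hi : i ∈ S) :
    pathLHS C D' S i j k p = 2 * (S.card : ℝ) + 4 -
      (total p.1 (delta (tgt (S ∪ {j, k}))) - total p.1 (between (dep D') (tgt {j}))
        - total p.1 (between (tgt {k}) (dep D'ᶜ))) - if mu C S = 0 then 1 - p.2 i else 0 := by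
  rw [pathLHS, sum_beta hjk hj hk hi, hp.two_mul_gamma]
  ring

/-- The unit of slack may come from any visited target of S, not only from i, because constraint 5
is imposed for each of them. This is what permits the coefficient 2 at i when S contains a cluster.
-/
theorem IsFeasible.pathLHS_le (hp : IsFeasible C p) {D' : Finset D} (hD' : D' ⊂ Finset.univ)
    {S : Finset T} {i j k : T} (hjk : j ≠ k) (hj : j ∉ S) (hk : k ∉ S) (hi : i ∈ S) :
    pathLHS C D' S i j k p ≤ 2 * (S.card : ℝ) + 3 := by
  rw [pathLHS_eq hp.toIsRelaxedSolution hjk hj hk hi]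
  have hcut := hp.le_delta D' (j := j) (k := k) (R := S ∪ {j, k}) (by simp) (by simp)
  have hone : ∀ v ∈ S, p.2 v = 1 →
      total p.1 (between (dep D') (tgt {j})) + total p.1 (between (tgt {k}) (dep D'ᶜ)) + 1
        ≤ total p.1 (delta (tgt (S ∪ {j, k}))) := by
    intro v hv hy
    have h := hp.path_many j k hjk S hj hk v hv D' hD'
    rw [hp.two_mul_gamma, Finset.sum_union (by simp [hj, hk]), Finset.sum_pair hjk, hy] at h
    linarith
  rcases hp.integral_visit i with hy | hy
  · by_cases hm : mu C S = 0
    · simp only [hm, hy, if_true]; linarith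
    · simp only [hm, if_false]
      obtain ⟨K, hK⟩ := Finset.card_ne_zero.1 hm
      rw [Finset.mem_filter] at hK
      have h1 := hp.cluster K hK.1
      obtain ⟨v, hv, hne⟩ := Finset.exists_ne_zero_of_sum_ne_zero
        (s := K) (f := p.2) (by linarith)
      have := hone v (hK.2 hv) ((hp.integral_visit v).resolve_left hne)
      linarith
  · have := hone i hi hy
    simp only [hy, sub_self, ite_self]
    linarith

end Relaxed

/-! ### Feasible points built from disjoint tours. -/

section Tours

variable {T D : Type*} [Fintype T] [Fintype D]

open Classical in
/-- The indicator of a single edge; it is zero if `q` is not an edge. -/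
def edgeInd (q : Sym2 (T ⊕ D)) : Edge T D → ℝ := fun e => if e.1 = q then 1 else 0

/-- The walk from the target `u` through the targets of `l` to the depot `d`. -/
def walk (d : D) : T → List T → (Edge T D → ℝ)
  | u, [] => edgeInd s(.inl u, .inr d)
  | u, v :: l => edgeInd s(.inl u, .inl v) + walk d v l

/-- A tour from a depot through a non-empty list of targets back to the depot. -/
structure Tour (T D : Type*) where
  depot : D
  head : T
  tail : List T

namespace Tour

/-- The targets of a tour, in the order of the tour. -/
def targets (t : Tour T D) : List T := t.head :: t.tail

/-- The edges of a tour, with multiplicity. -/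
def vec (t : Tour T D) : Edge T D → ℝ :=
  edgeInd s(.inr t.depot, .inl t.head) + walk t.depot t.head t.tail

end Tour

/-- All targets on a list of tours. -/
def visits (L : List (Tour T D)) : List T := L.flatMap Tour.targets

/-- The pair `(x, y)` of a list of tours. -/
def toursPoint [DecidableEq T] (L : List (Tour T D)) : Point T D :=
  ((L.map Tour.vec).sum, fun v => ((visits L).count v : ℝ))

theorem total_add (x x' : Edge T D → ℝ) (F : Finset (Edge T D)) :
    total (x + x') F = total x F + total x' F := Finset.sum_add_distrib

theorem total_zero (F : Finset (Edge T D)) : total 0 F = 0 := Finset.sum_const_zero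

theorem total_smul (c : ℝ) (x : Edge T D → ℝ) (F : Finset (Edge T D)) :
    total (c • x) F = c * total x F := by simp [total, Finset.mul_sum]

theorem total_list_sum (L : List (Tour T D)) (F : Finset (Edge T D)) :
    total (L.map Tour.vec).sum F = (L.map fun t => total t.vec F).sum := by
  induction L with
  | nil => exact total_zero F
  | cons t L ih => simp [total_add, ih]

theorem edgeInd_eq_single {q : Sym2 (T ⊕ D)} (hq : q ∈ (graph T D).edgeSet)
    [DecidableEq (Edge T D)] :
    edgeInd q = Pi.single (⟨q, hq⟩ : Edge T D) 1 := by
  funext e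
  have : e.1 = q ↔ e = ⟨q, hq⟩ := by rw [Subtype.ext_iff]
  simp [edgeInd, Pi.single_apply, this]

theorem edgeInd_eq_zero {q : Sym2 (T ⊕ D)} (hq : q ∉ (graph T D).edgeSet) :
    edgeInd q = 0 := by
  funext e
  have : e.1 ≠ q := fun h => hq (h ▸ e.2)
  simp [edgeInd, this]

open Classical in
theorem total_edgeInd {q : Sym2 (T ⊕ D)} (hq : q ∈ (graph T D).edgeSet)
    (F : Finset (Edge T D)) : total (edgeInd q) F = if ⟨q, hq⟩ ∈ F then 1 else 0 := by
  rw [edgeInd_eq_single hq, total, Finset.sum_pi_single']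

open Classical in
theorem total_edgeInd_delta (u v : T ⊕ D) (S : Finset T) :
    total (edgeInd s(u, v)) (delta (tgt S)) =
      if (u ∈ tgt S ∧ v ∉ tgt S) ∨ (v ∈ tgt S ∧ u ∉ tgt S) then 1 else 0 := by
  by_cases h : s(u, v) ∈ (graph T D).edgeSet
  · simp only [total_edgeInd h, mem_delta]
  -- A non-edge is a loop or a pair of depots, and neither crosses a cut of a set of targets.
  · rw [edgeInd_eq_zero h, total_zero, if_neg]
    intro hc
    apply h
    rw [SimpleGraph.mem_edgeSet]
    rcases u with a | d <;> rcases v with b | e <;> simp at hc ⊢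
    rintro rfl
    simp at hc

theorem edgeInd_exists_nat (q : Sym2 (T ⊕ D)) (e : Edge T D) : ∃ n : ℕ, edgeInd q e = n := by
  unfold edgeInd
  split_ifs
  · exact ⟨1, by simp⟩
  · exact ⟨0, by simp⟩

theorem walk_exists_nat (d : D) (u : T) (l : List T) (e : Edge T D) :
    ∃ n : ℕ, walk d u l e = n := by
  induction l generalizing u with
  | nil => exact edgeInd_exists_nat _ _
  | cons v l ih =>
    obtain ⟨m, hm⟩ := edgeInd_exists_nat s(.inl u, .inl v) e
    obtain ⟨n, hn⟩ := ih v
    exact ⟨m + n, by simp [walk, hm, hn]⟩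

theorem Tour.vec_exists_nat (t : Tour T D) (e : Edge T D) : ∃ n : ℕ, t.vec e = n := by
  obtain ⟨m, hm⟩ := edgeInd_exists_nat s(.inr t.depot, .inl t.head) e
  obtain ⟨n, hn⟩ := walk_exists_nat t.depot t.head t.tail e
  exact ⟨m + n, by simp [Tour.vec, hm, hn]⟩

theorem toursPoint_exists_nat [DecidableEq T] (L : List (Tour T D)) (e : Edge T D) :
    ∃ n : ℕ, (toursPoint L).1 e = n := by
  induction L with
  | nil => exact ⟨0, by simp [toursPoint]⟩
  | cons t L ih =>
    obtain ⟨m, hm⟩ := ih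
    obtain ⟨n, hn⟩ := t.vec_exists_nat e
    exact ⟨n + m, by simp [toursPoint, hn] at hm ⊢; exact hm⟩

theorem Tour.vec_nonneg (t : Tour T D) (e : Edge T D) : 0 ≤ t.vec e := by
  obtain ⟨n, hn⟩ := t.vec_exists_nat e
  simp [hn]

theorem walk_nonneg (d : D) (u : T) (l : List T) (e : Edge T D) : 0 ≤ walk d u l e := by
  obtain ⟨n, hn⟩ := walk_exists_nat d u l e
  simp [hn]

theorem walk_ne_zero {d : D} {u : T} {l : List T} {e : Edge T D} (h : walk d u l e ≠ 0) :
    ∀ v ∈ e.1, v = .inr d ∨ ∃ a ∈ u :: l, v = .inl a := by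
  induction l generalizing u with
  | nil =>
    have : e.1 = s(.inl u, .inr d) := by
      by_contra hne; exact h (by simp [walk, edgeInd, hne])
    rw [this]
    simp
  | cons w l ih =>
    intro v hv
    by_cases h' : walk d w l e = 0
    · have : e.1 = s(.inl u, .inl w) := by
        by_contra hne; exact h (by simp [walk, edgeInd, hne, h'])
      rw [this] at hv
      simp at hv ⊢
      grind
    · have := ih h' v hv
      simp at this ⊢
      tauto

theorem Tour.vec_ne_zero {t : Tour T D} {e : Edge T D} (h : t.vec e ≠ 0) :
    ∀ v ∈ e.1, v = .inr t.depot ∨ ∃ a ∈ t.targets, v = .inl a := by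
  intro v hv
  by_cases h' : walk t.depot t.head t.tail e = 0
  · have : e.1 = s(.inr t.depot, .inl t.head) := by
      by_contra hne; exact h (by simp [Tour.vec, edgeInd, hne, h'])
    rw [this] at hv
    simp [targets] at hv ⊢
    tauto
  · exact walk_ne_zero h' v hv

variable [DecidableEq T]

theorem total_walk_delta_singleton (d : D) (u : T) (l : List T) (h : (u :: l).Nodup) (i : T) :
    total (walk d u l) (delta (tgt {i})) = (if u = i then 1 else 0) + 2 * (l.count i : ℝ) := by
  induction l generalizing u with
  | nil => simp [walk, total_edgeInd_delta]
  | cons v l ih =>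
    have huv : u ≠ v := by simp at h; tauto
    rw [walk, total_add, ih v (List.nodup_cons.1 h).2, total_edgeInd_delta]
    simp only [inl_mem_tgt, Finset.mem_singleton, List.count_cons, beq_iff_eq]
    by_cases h1 : u = i
    · subst h1; simp [huv.symm]
    · by_cases h2 : v = i
      · subst h2; simp [h1]; ring
      · simp [h1, h2]

theorem Tour.total_vec_delta_singleton (t : Tour T D) (h : t.targets.Nodup) (i : T) :
    total t.vec (delta (tgt {i})) = 2 * (t.targets.count i : ℝ) := by
  rw [Tour.vec, total_add, total_walk_delta_singleton _ _ _ h, total_edgeInd_delta, Tour.targets,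
    List.count_cons]
  by_cases h1 : t.head = i
  · simp [h1]; ring
  · simp [h1]

/-- The walk ends at a depot, hence outside S: it must leave S, and must first enter S if it starts
outside. -/
theorem total_walk_delta_ge (d : D) (u : T) (l : List T) (S : Finset T) :
    (u ∈ S → 1 ≤ total (walk d u l) (delta (tgt S))) ∧
    (∀ v ∈ l, u ∉ S → v ∈ S → 2 ≤ total (walk d u l) (delta (tgt S))) := by
  induction l generalizing u with
  | nil => simp +contextual [walk, total_edgeInd_delta]
  | cons w l ih =>
    have h0 := total_nonneg (walk_nonneg d w l) (delta (tgt S))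
    obtain ⟨h1, h2⟩ := ih w
    rw [walk, total_add, total_edgeInd_delta]
    simp only [inl_mem_tgt]
    constructor
    · intro hu
      by_cases hw : w ∈ S
      · have := h1 hw; simp [hu, hw]; exact this
      · simp [hu, hw]; exact h0
    · intro v hv hu hvS
      by_cases hw : w ∈ S
      · have := h1 hw; simp [hu, hw]; linarith
      · simp only [hu, hw]
        have hvl : v ∈ l := by
          rcases List.mem_cons.1 hv with rfl | h
          · exact absurd hvS hw
          · exact h
        simpa using h2 v hvl hw hvS

theorem Tour.two_le_total_vec_delta (t : Tour T D) {S : Finset T} {v : T} (hv : v ∈ t.targets)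
    (hS : v ∈ S) : 2 ≤ total t.vec (delta (tgt S)) := by
  obtain ⟨h1, h2⟩ := total_walk_delta_ge t.depot t.head t.tail S
  rw [Tour.vec, total_add, total_edgeInd_delta]
  by_cases h : t.head ∈ S
  · have := h1 h; simp [h]; linarith
  · have hvt : v ∈ t.tail := by
      rcases List.mem_cons.1 hv with rfl | h'
      · exact absurd hS h
      · exact h'
    have := h2 v hvt h hS
    simpa [h] using this

theorem tour_eq_of_mem {L : List (Tour T D)} (hL : (visits L).Nodup) {t t' : Tour T D}
    (ht : t ∈ L) (ht' : t' ∈ L) {a : T} (ha : a ∈ t.targets) (ha' : a ∈ t'.targets) : t = t' := by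
  by_contra hne
  have h := (List.nodup_flatMap.1 hL).2
  have : Std.Symm (Function.onFun List.Disjoint (Tour.targets (T := T) (D := D))) :=
    ⟨fun _ _ h => List.Disjoint.symm h⟩
  exact List.Pairwise.forall h ht ht' hne ha ha'

theorem toursPoint_degree {L : List (Tour T D)} (hL : (visits L).Nodup) (i : T) :
    total (toursPoint L).1 (delta (tgt {i})) = 2 * (toursPoint L).2 i := by
  have h : ∀ t ∈ L, total t.vec (delta (tgt {i})) = 2 * (t.targets.count i : ℝ) :=
    fun t ht => t.total_vec_delta_singleton ((List.nodup_flatMap.1 hL).1 t ht) i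
  simp only [toursPoint, total_list_sum, List.map_congr_left h, visits, List.count_flatMap]
  rw [List.sum_map_mul_left, Nat.cast_list_sum, List.map_map]
  congr 2

theorem exists_tour_of_ne_zero {L : List (Tour T D)} {e : Edge T D}
    (h : (toursPoint L).1 e ≠ 0) : ∃ t ∈ L, t.vec e ≠ 0 := by
  by_contra! h'
  apply h
  simp only [toursPoint]
  clear h
  induction L with
  | nil => rfl
  | cons t L ih =>
    rw [List.map_cons, List.sum_cons, Pi.add_apply, h' t (by simp), zero_add]
    exact ih fun t ht => h' t (by simp [ht])

variable [DecidableEq D] {C : Finpartition (Finset.univ : Finset T)}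

theorem toursPoint_snd {L : List (Tour T D)} (hL : (visits L).Nodup) (v : T) :
    (toursPoint L).2 v = if v ∈ visits L then 1 else 0 := by
  simp only [toursPoint]
  rw [List.Nodup.count hL]
  split_ifs <;> simp

/-- Because the tours share no targets, each connected piece of the target support stays within one
tour and so meets only one depot. -/
theorem toursPoint_isRouting {L : List (Tour T D)} (hL : (visits L).Nodup)
    (hC : ∀ K ∈ C.parts, ∃ v ∈ K, v ∈ visits L) : IsRouting C (toursPoint L) := by
  have hx0 : ∀ e, 0 ≤ (toursPoint L).1 e := fun e => by
    obtain ⟨n, hn⟩ := toursPoint_exists_nat L e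
    simp [hn]
  have hy0 : ∀ v, 0 ≤ (toursPoint L).2 v := fun v => by rw [toursPoint_snd hL]; split_ifs <;> simp
  have hy1 : ∀ v, (toursPoint L).2 v ≤ 1 := fun v => by rw [toursPoint_snd hL]; split_ifs <;> simp
  have hsub : ∀ S : Finset T, ∀ i ∈ S,
      2 * (toursPoint L).2 i ≤ total (toursPoint L).1 (delta (tgt S)) := by
    intro S i hi
    rw [toursPoint_snd hL]
    split_ifs with h
    · obtain ⟨t, ht, hit⟩ := List.mem_flatMap.1 h
      simp only [toursPoint, total_list_sum]
      have h2 := t.two_le_total_vec_delta hit hi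
      have := List.single_le_sum (l := L.map fun t => total t.vec (delta (tgt S)))
        (by simpa using fun t _ => total_nonneg t.vec_nonneg _) _ (List.mem_map_of_mem ht)
      linarith
    · simpa using total_nonneg hx0 _
  have hdeg := toursPoint_degree hL
  have hedge : ∀ (e : Edge T D) (i : T), .inl i ∈ e.1 → (toursPoint L).1 e ≤ 2 := by
    intro e i hi
    have he : e ∈ delta (tgt (D := D) {i}) := by
      induction e using edge_cases with
      | target a b h =>
        have : a ≠ b := by simpa using h
        simp only [mem_delta]; simp at hi ⊢; grind
      | depot d a h => simp only [mem_delta]; simp at hi ⊢; exact hi.symm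
    have := Finset.single_le_sum (f := (toursPoint L).1) (fun e _ => hx0 e) he
    have h2 := hdeg i
    have h3 := hy1 i
    simp only [total] at h2
    linarith
  have hsupp : ∀ t ∈ L, ∀ a b, (targetSupport (toursPoint L).1).Adj a b →
      a ∈ t.targets → b ∈ t.targets := by
    intro t ht a b hab ha
    rw [targetSupport_adj] at hab
    have he : s(.inl a, .inl b) ∈ (graph T D).edgeSet := by simpa using hab.1
    rw [total_between_targets _ he] at hab
    obtain ⟨t', ht', h'⟩ := exists_tour_of_ne_zero hab.2
    have h1 := Tour.vec_ne_zero h' (.inl a) (by simp)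
    have h2 := Tour.vec_ne_zero h' (.inl b) (by simp)
    simp at h1 h2
    rwa [tour_eq_of_mem hL ht ht' ha h1]
  have hreach : ∀ t ∈ L, ∀ a b, (targetSupport (toursPoint L).1).Reachable a b →
      a ∈ t.targets → b ∈ t.targets := by
    rintro t ht a b ⟨w⟩
    induction w with
    | nil => exact id
    | cons h _ ih => exact fun ha => ih (hsupp t ht _ _ h ha)
  refine ⟨⟨hdeg, ?_, hsub, ?_, ?_, ?_⟩, ?_⟩
  · intro K hK
    obtain ⟨v, hvK, hv⟩ := hC K hK
    have := Finset.single_le_sum (f := (toursPoint L).2) (fun v _ => hy0 v) hvK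
    rwa [toursPoint_snd hL, if_pos hv] at this
  · intro e _
    obtain ⟨n, hn⟩ := toursPoint_exists_nat L e
    induction e using edge_cases with
    | target a b h =>
      have hab : a ≠ b := by simpa using h
      -- Sub-tour elimination on {a, b} and the two degree equations bound the edge between a and b
      -- by 1.
      have h1 := hsub {a, b} a (by simp)
      have h1' := hsub {a, b} b (by simp)
      have h2 := sum_total_delta (toursPoint L).1 ({a, b} : Finset T)
      rw [Finset.sum_pair hab, hdeg, hdeg] at h2
      have h3 := Finset.single_le_sum (f := (toursPoint L).1) (fun e _ => hx0 e)
        (show (⟨_, h⟩ : Edge T D) ∈ gamma (tgt {a, b}) by simp [mem_gamma])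
      have h4 := hy1 a
      have h5 := hy1 b
      simp only [total] at h1 h1' h2
      rw [hn] at h3 ⊢
      have : (n : ℝ) ≤ 1 := by linarith
      have : n ≤ 1 := by exact_mod_cast this
      interval_cases n <;> simp
    | depot d a h => simp_all [mem_gamma]
  · intro e _
    obtain ⟨n, hn⟩ := toursPoint_exists_nat L e
    have : (toursPoint L).1 e ≤ 2 := by
      induction e using edge_cases with
      | target a b h => exact hedge _ a (by simp)
      | depot d a h => exact hedge _ a (by simp)
    rw [hn] at this ⊢
    have : n ≤ 2 := by exact_mod_cast this
    interval_cases n <;> simp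
  · intro i
    rw [toursPoint_snd hL]
    split_ifs <;> simp
  · intro d₁ d₂ hd a b _ hr h1
    by_contra h2
    rw [total_between_depot _ (by simp)] at h1 h2
    obtain ⟨t₁, ht₁, h1⟩ := exists_tour_of_ne_zero h1
    obtain ⟨t₂, ht₂, h2⟩ := exists_tour_of_ne_zero h2
    have p1 := Tour.vec_ne_zero h1 (.inr d₁) (by simp)
    have p2 := Tour.vec_ne_zero h2 (.inr d₂) (by simp)
    have q1 := Tour.vec_ne_zero h1 (.inl a) (by simp)
    have q2 := Tour.vec_ne_zero h2 (.inl b) (by simp)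
    simp at p1 p2 q1 q2
    have := tour_eq_of_mem hL ht₁ ht₂ (hreach t₁ ht₁ a b hr q1) q2
    exact hd (by rw [p1, p2, this])

end Tours

/-! ### The slack of individual tours. -/

section Slack

variable {T D : Type*} [Fintype T] [Fintype D] [DecidableEq T] [DecidableEq D]

/-- The cut of `S ∪ {j, k}` minus the depot edges that occur in the path inequality. -/
def slack (D' : Finset D) (S : Finset T) (j k : T) (x : Edge T D → ℝ) : ℝ :=
  total x (delta (tgt (S ∪ {j, k}))) - total x (between (dep D') (tgt {j}))
    - total x (between (tgt {k}) (dep D'ᶜ))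

variable {D' : Finset D} {S : Finset T} {j k : T}

theorem slack_swap (x : Edge T D → ℝ) : slack D'ᶜ S k j x = slack D' S j k x := by
  rw [slack, slack, compl_compl, Finset.pair_comm, between_comm (dep D'ᶜ),
    between_comm _ (dep D')]
  ring

theorem slack_add (x x' : Edge T D → ℝ) :
    slack D' S j k (x + x') = slack D' S j k x + slack D' S j k x' := by
  simp only [slack, total_add]; ring

theorem slack_list_sum (L : List (Tour T D)) :
    slack D' S j k (L.map Tour.vec).sum = (L.map fun t => slack D' S j k t.vec).sum := by
  induction L with
  | nil => simp [slack, total_zero]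
  | cons t L ih => simp [slack_add, ih]

theorem slack_edgeInd_target (a b : T) : slack D' S j k (edgeInd s(.inl a, .inl b)) =
    if (a ∈ S ∪ {j, k} ∧ b ∉ S ∪ {j, k}) ∨ (b ∈ S ∪ {j, k} ∧ a ∉ S ∪ {j, k}) then 1 else 0 := by
  by_cases h : s((.inl a : T ⊕ D), .inl b) ∈ (graph T D).edgeSet
  · rw [slack, total_edgeInd_delta, total_edgeInd h, total_edgeInd h]
    simp [mem_between]
  · have hab : a = b := by simpa using h
    subst hab
    rw [edgeInd_eq_zero h, if_neg (by tauto)]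
    simp [slack, total_zero]

theorem slack_edgeInd_depot (a : T) (d : D) : slack D' S j k (edgeInd s(.inl a, .inr d)) =
    (if a ∈ S ∪ {j, k} then 1 else 0) - (if a = j ∧ d ∈ D' then 1 else 0)
      - (if a = k ∧ d ∉ D' then 1 else 0) := by
  have h : s((.inl a : T ⊕ D), .inr d) ∈ (graph T D).edgeSet := by simp
  rw [slack, total_edgeInd_delta, total_edgeInd h, total_edgeInd h]
  simp [mem_between, and_comm]

theorem slack_walk_outside {d : D} {u : T} {l : List T} (h : ∀ v ∈ u :: l, v ∉ S ∪ {j, k}) :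
    slack D' S j k (walk d u l) = 0 := by
  induction l generalizing u with
  | nil =>
    have hu := h u (by simp)
    rw [walk, slack_edgeInd_depot]
    simp at hu ⊢
    simp [hu]
  | cons v l ih =>
    rw [walk, slack_add, ih fun w hw => h w (List.mem_cons_of_mem _ hw), slack_edgeInd_target,
      if_neg, add_zero]
    have h1 := h u (by simp)
    have h2 := h v (by simp)
    tauto

theorem slack_vec_outside {t : Tour T D} (h : ∀ v ∈ t.targets, v ∉ S ∪ {j, k}) :
    slack D' S j k t.vec = 0 := by
  rw [Tour.vec, slack_add, slack_walk_outside h, Sym2.eq_swap, slack_edgeInd_depot]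
  have h1 := h t.head (by simp [Tour.targets])
  simp at h1 ⊢
  simp [h1]

theorem slack_walk {d : D} (hd : d ∈ D') {u : T} {l m : List T}
    (hl : ∀ v ∈ u :: l, v ∈ S ∪ {j, k} ∧ v ≠ j) (hm : ∀ v ∈ m, v ∉ S ∪ {j, k}) :
    slack D' S j k (walk d u (l ++ m)) = 1 := by
  induction l generalizing u with
  | nil =>
    obtain ⟨h1, h2⟩ := hl u (by simp)
    rcases m with _ | ⟨v, m⟩
    · simp only [List.append_nil, walk]
      rw [slack_edgeInd_depot, if_pos h1]
      simp [hd, h2]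
    · simp only [List.nil_append, walk]
      rw [slack_add, slack_walk_outside hm, slack_edgeInd_target, if_pos, add_zero]
      exact Or.inl ⟨h1, hm v (by simp)⟩
  | cons v l ih =>
    have h1 := (hl u (by simp)).1
    have h2 := (hl v (by simp)).1
    simp only [List.cons_append, walk]
    rw [slack_add, ih fun w hw => hl w (List.mem_cons_of_mem _ hw), slack_edgeInd_target,
      if_neg (by tauto), zero_add]

/-- The first edge dj is cancelled. The tour then leaves S ∪ {j, k} exactly once, after `l`, by an
edge that is not cancelled, even if it returns directly from k, since d ∈ D'. -/
theorem slack_vec {d : D} (hd : d ∈ D') (hjk : j ≠ k) {l m : List T} (hne : l ≠ [])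
    (hl : ∀ v ∈ l, v ∈ S ∪ {j, k} ∧ v ≠ j) (hm : ∀ v ∈ m, v ∉ S ∪ {j, k}) :
    slack D' S j k (Tour.vec ⟨d, j, l ++ m⟩) = 1 := by
  obtain ⟨u, l, rfl⟩ := List.exists_cons_of_ne_nil hne
  have h1 := (hl u (by simp)).1
  simp only [Tour.vec, List.cons_append, walk]
  have hj : j ∈ S ∪ {j, k} := by simp
  rw [slack_add, slack_add, slack_walk hd hl hm, slack_edgeInd_target, if_neg (by tauto),
    Sym2.eq_swap, slack_edgeInd_depot]
  simp [hd, hjk]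

/-- The edge dj is used twice, and both uses are cancelled. -/
theorem slack_vec_single {d : D} (hd : d ∈ D') (hjk : j ≠ k) :
    slack D' S j k (Tour.vec ⟨d, j, []⟩) = 0 := by
  simp only [Tour.vec, walk]
  rw [slack_add, Sym2.eq_swap, slack_edgeInd_depot]
  simp [hd, hjk]

end Slack

/-! ### Tours on the face and functionals constant on it. -/

section Face

variable {T D : Type*} [Fintype T] [Fintype D] [DecidableEq T] [DecidableEq D]
  {C : Finpartition (Finset.univ : Finset T)} {D' : Finset D} {S : Finset T} {i j k : T}

theorem pathLHS_swap (p : Point T D) : pathLHS C D'ᶜ S i k j p = pathLHS C D' S i j k p := by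
  have : beta C S i k j = beta C S i j k := by
    funext v; simp only [beta, Finset.pair_comm k j]
  rw [pathLHS, pathLHS, this, compl_compl, Finset.pair_comm, between_comm (dep D'ᶜ),
    between_comm _ (dep D')]
  ring

/-- The face of `P` that the path inequality induces. -/
def face (C : Finpartition (Finset.univ : Finset T)) (D' : Finset D) (S : Finset T) (i j k : T) :
    Set (Point T D) :=
  {p ∈ polytope D C | pathLHS C D' S i j k p = 2 * (S.card : ℝ) + 3}

theorem face_swap : face C D'ᶜ S i k j = face C D' S i j k := by
  simp only [face, pathLHS_swap]

/-- Routing points suffice here because the absence of paths between depots already implies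
constraints 4 and 5. -/
theorem toursPoint_mem_polytope {L : List (Tour T D)} (hL : (visits L).Nodup)
    (hC : ∀ K ∈ C.parts, ∃ v ∈ K, v ∈ visits L) : toursPoint L ∈ polytope D C :=
  subset_convexHull ℝ _ (toursPoint_isRouting hL hC).isFeasible

theorem toursPoint_mem_face {L : List (Tour T D)} (hL : (visits L).Nodup)
    (hC : ∀ K ∈ C.parts, ∃ v ∈ K, v ∈ visits L)
    (hjk : j ≠ k) (hj : j ∉ S) (hk : k ∉ S) (hi : i ∈ S)
    (h : (L.map fun t => slack D' S j k t.vec).sum =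
      if mu C S = 0 ∧ i ∉ visits L then 0 else 1) : toursPoint L ∈ face C D' S i j k := by
  refine ⟨toursPoint_mem_polytope hL hC, ?_⟩
  have hp := (toursPoint_isRouting hL hC).toIsRelaxedSolution
  rw [pathLHS_eq hp hjk hj hk hi, ← slack, toursPoint_snd hL]
  simp only [toursPoint]
  rw [slack_list_sum, h]
  split_ifs <;> first | ring1 | (exfalso; tauto)

/-- The tours that visit each target of `R` alone from the depot `d`. -/
def singles (d : D) (R : Finset T) : List (Tour T D) := R.toList.map fun v => ⟨d, v, []⟩

theorem visits_singles (d : D) (R : Finset T) : visits (singles d R) = R.toList := by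
  simp [visits, singles, List.flatMap_map, Tour.targets]

theorem visits_append (L L' : List (Tour T D)) : visits (L ++ L') = visits L ++ visits L' := by
  simp [visits]

theorem map_toursPoint (G : Point T D →ₗ[ℝ] ℝ) {L : List (Tour T D)} (hL : (visits L).Nodup) :
    G (toursPoint L) = (L.map fun t => G (t.vec, 0)).sum
      + ∑ v ∈ (visits L).toFinset, G (0, Pi.single v 1) := by
  have h1 : toursPoint L = ((toursPoint L).1, 0) + (0, (toursPoint L).2) := by simp
  have h2 : (0, (toursPoint L).2)
      = ∑ v ∈ (visits L).toFinset, ((0 : Edge T D → ℝ), (Pi.single v (1 : ℝ) : T → ℝ)) := by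
    rw [Prod.ext_iff]
    constructor
    · simp [Prod.fst_sum]
    · funext v
      simp [Prod.snd_sum, toursPoint_snd hL, Finset.sum_apply, Pi.single_apply]
  have h3 : ∀ L : List (Tour T D),
      G ((L.map Tour.vec).sum, 0) = (L.map fun t => G (t.vec, 0)).sum := by
    intro L
    induction L with
    | nil => exact map_zero G
    | cons t L ih =>
      rw [List.map_cons, List.map_cons, List.sum_cons, List.sum_cons, ← ih, ← map_add]
      simp
  rw [h1, map_add, h2, map_sum]
  simp only [toursPoint, h3]

/-- A linear functional that is constant on the face and vanishes on the edges that join the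
targets outside `S ∪ {j, k}` to a given depot `d₀`. -/
structure IsFaceFunctional (C : Finpartition (Finset.univ : Finset T)) (D' : Finset D)
    (S : Finset T) (i j k : T) (d₀ : D) (G : Point T D →ₗ[ℝ] ℝ) (c : ℝ) : Prop where
  ne : j ≠ k
  left : j ∉ S
  right : k ∉ S
  inner : i ∈ S
  const : ∀ p ∈ face C D' S i j k, G p = c
  outside : ∀ v ∉ S ∪ {j, k}, G (edgeInd s(.inr d₀, .inl v), 0) = 0

namespace IsFaceFunctional

variable {d₀ : D} {G : Point T D →ₗ[ℝ] ℝ} {c : ℝ}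

theorem swap (hG : IsFaceFunctional C D' S i j k d₀ G c) :
    IsFaceFunctional C D'ᶜ S i k j d₀ G c where
  ne := hG.ne.symm
  left := hG.right
  right := hG.left
  inner := hG.inner
  const := by rw [face_swap]; exact hG.const
  outside := by rw [Finset.pair_comm]; exact hG.outside

/-- The value on tours that cover the visited part of `S ∪ {j, k}`; the other targets of `U` are
visited alone from `d₀`. -/
theorem sum_eq (hG : IsFaceFunctional C D' S i j k d₀ G c) {L : List (Tour T D)} {U : Finset T}
    (hL : (visits L).Nodup) (hsub : ∀ v ∈ visits L, v ∈ U)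
    (hcov : ∀ v ∈ U, v ∈ S ∪ {j, k} → v ∈ visits L)
    (hC : ∀ K ∈ C.parts, ∃ v ∈ K, v ∈ U)
    (h : (L.map fun t => slack D' S j k t.vec).sum = if mu C S = 0 ∧ i ∉ U then 0 else 1) :
    (L.map fun t => G (t.vec, 0)).sum + ∑ v ∈ U, G (0, Pi.single v 1) = c := by
  set R : Finset T := U \ (visits L).toFinset with hR
  have hRout : ∀ v ∈ R, v ∉ S ∪ {j, k} := by
    intro v hv hv'
    simp only [hR, Finset.mem_sdiff, List.mem_toFinset] at hv
    exact hv.2 (hcov v hv.1 hv')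
  have hmem : ∀ v, v ∈ visits (L ++ singles d₀ R) ↔ v ∈ U := by
    intro v
    simp only [visits_append, visits_singles, List.mem_append, Finset.mem_toList, hR,
      Finset.mem_sdiff, List.mem_toFinset]
    have := hsub v
    tauto
  have hnd : (visits (L ++ singles d₀ R)).Nodup := by
    rw [visits_append, visits_singles, List.nodup_append]
    refine ⟨hL, R.nodup_toList, ?_⟩
    rintro a ha b hb rfl
    simp [hR, ha] at hb
  have hface := toursPoint_mem_face (D' := D') hnd (C := C) (by simpa only [hmem] using hC)
    hG.ne hG.left hG.right hG.inner (by
      simp only [hmem]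
      rw [← h, List.map_append, List.sum_append, add_eq_left]
      apply List.sum_eq_zero
      simp only [singles, List.map_map, List.mem_map, Finset.mem_toList]
      rintro _ ⟨v, hv, rfl⟩
      exact slack_vec_outside (by simpa [Tour.targets] using hRout v hv))
  have hval := hG.const _ hface
  rw [map_toursPoint G hnd, List.map_append, List.sum_append] at hval
  have hU : (visits (L ++ singles d₀ R)).toFinset = U := by
    ext v; rw [List.mem_toFinset, hmem]
  -- The normalization at d₀ makes the filler tours free, so values with different outside tours can
  -- be compared directly.
  have hzero : ((singles d₀ R).map fun t => G (t.vec, 0)).sum = 0 := by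
    apply List.sum_eq_zero
    simp only [singles, List.map_map, List.mem_map, Finset.mem_toList]
    rintro _ ⟨v, hv, rfl⟩
    have h0 := hG.outside v (hRout v hv)
    have : (Tour.vec ⟨d₀, v, []⟩, (0 : T → ℝ)) =
        (edgeInd s(.inr d₀, .inl v), 0) + (edgeInd s(.inr d₀, .inl v), 0) := by
      simp [Tour.vec, walk, Sym2.eq_swap]
    simp only [Function.comp]
    rw [this, map_add, h0, add_zero]
  rwa [hU, hzero, add_zero] at hval

/-- A single tour from `D'` that starts with `j`, together with tours outside `S ∪ {j, k}`. -/
theorem one_tour (hG : IsFaceFunctional C D' S i j k d₀ G c) {d : D} (hd : d ∈ D')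
    {U : Finset T} (hC : ∀ K ∈ C.parts, ∃ v ∈ K, v ∈ U) (hU : mu C S = 0 → i ∈ U)
    {l m : List T} {L : List (Tour T D)} (hne : l ≠ [])
    (hl : ∀ v ∈ l, v ∈ S ∪ {j, k}) (hm : ∀ v ∈ m ++ visits L, v ∉ S ∪ {j, k})
    (hnd : (j :: l ++ (m ++ visits L)).Nodup)
    (hsub : ∀ v ∈ j :: l ++ (m ++ visits L), v ∈ U)
    (hcov : ∀ v ∈ U, v ∈ S ∪ {j, k} → v ∈ j :: l) :
    G (Tour.vec ⟨d, j, l ++ m⟩, 0) + (L.map fun t => G (t.vec, 0)).sum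
      + ∑ v ∈ U, G (0, Pi.single v 1) = c := by
  have hv : visits (⟨d, j, l ++ m⟩ :: L) = j :: l ++ (m ++ visits L) := by
    simp [visits, Tour.targets]
  have := hG.sum_eq (L := ⟨d, j, l ++ m⟩ :: L) (U := U) (by rwa [hv]) (by rwa [hv])
    (fun v hvU hvS => by rw [hv]; exact List.mem_append_left _ (hcov v hvU hvS)) hC (by
      rw [if_neg (by tauto), List.map_cons, List.sum_cons, slack_vec hd hG.ne hne]
      · rw [add_eq_left]
        apply List.sum_eq_zero
        simp only [List.mem_map]
        rintro _ ⟨t, ht, rfl⟩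
        exact slack_vec_outside fun v hv => hm v (List.mem_append_right _
          (List.mem_flatMap.2 ⟨t, ht, hv⟩))
      · intro v hvl
        refine ⟨hl v hvl, ?_⟩
        rintro rfl
        rw [List.cons_append, List.nodup_cons] at hnd
        exact hnd.1 (List.mem_append_left _ hvl)
      · exact fun v hv => hm v (List.mem_append_left _ hv))
  simpa using this

/-- A tour from `D'` that visits `j` alone, and a tour from the other depots that starts with
`k`. -/
theorem two_tours (hG : IsFaceFunctional C D' S i j k d₀ G c) {d e : D} (hd : d ∈ D')
    (he : e ∉ D') {l m : List T} (hne : l ≠ []) (hnd : l.Nodup) (hl : ∀ v, v ∈ l ↔ v ∈ S)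
    (hm : ∀ v ∈ m, v ∉ S ∪ {j, k}) (hmnd : m.Nodup) :
    G (Tour.vec ⟨d, j, []⟩, 0) + G (Tour.vec ⟨e, k, l ++ m⟩, 0)
      + ∑ v, G (0, Pi.single v 1) = c := by
  have hv : visits [⟨d, j, []⟩, ⟨e, k, l ++ m⟩] = j :: k :: (l ++ m) := by
    simp [visits, Tour.targets]
  have h1 := hG.ne
  have h2 := hG.left
  have h3 := hG.right
  have := hG.sum_eq (L := [⟨d, j, []⟩, ⟨e, k, l ++ m⟩]) (U := Finset.univ)
    (by
      rw [hv]
      simp only [List.nodup_cons, List.mem_cons, List.mem_append, List.nodup_append, hl]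
      simp only [Finset.mem_union, Finset.mem_insert, Finset.mem_singleton] at hm
      refine ⟨by grind, by grind, hnd, hmnd, by grind⟩)
    (by simp) (by rw [hv]; simp [hl]; tauto)
    (fun K hK => by
      obtain ⟨v, hv⟩ := C.nonempty_of_mem_parts hK
      exact ⟨v, hv, Finset.mem_univ _⟩)
    (by
      rw [if_neg (by simp)]
      simp only [List.map_cons, List.map_nil, List.sum_cons, List.sum_nil]
      rw [slack_vec_single hd hG.ne, ← slack_swap, slack_vec (Finset.mem_compl.2 he) hG.ne.symm hne]
      · simp
      · intro v hvl
        refine ⟨by simp [(hl v).1 hvl], ?_⟩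
        rintro rfl
        exact h3 ((hl v).1 hvl)
      · rwa [Finset.pair_comm])
  simpa using this

end IsFaceFunctional

/-- The sum of `G` over the edges of the path through `u` and then `l`. -/
def chain (G : Point T D →ₗ[ℝ] ℝ) : T → List T → ℝ
  | _, [] => 0
  | u, v :: l => G (edgeInd s(.inl u, .inl v), 0) + chain G v l

theorem chain_append (G : Point T D →ₗ[ℝ] ℝ) (u v : T) (l m : List T) :
    chain G u (l ++ v :: m) = chain G u (l ++ [v]) + chain G v m := by
  induction l generalizing u with
  | nil => simp [chain]
  | cons w l ih => simp only [List.cons_append, chain, ih]; ring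

theorem map_walk (G : Point T D →ₗ[ℝ] ℝ) (d : D) (u v : T) (l : List T) :
    G (walk d u (l ++ [v]), 0) =
      chain G u (l ++ [v]) + G (edgeInd s(.inr d, .inl v), 0) := by
  have hadd : ∀ x y : Edge T D → ℝ, G (x + y, 0) = G (x, 0) + G (y, 0) := by
    intro x y; rw [← map_add]; simp
  induction l generalizing u with
  | nil =>
    have : s((.inl v : T ⊕ D), .inr d) = s(.inr d, .inl v) := Sym2.eq_swap
    simp only [List.nil_append, walk, hadd, chain, add_zero, this]
  | cons w l ih => simp only [List.cons_append, walk, chain, hadd, ih]; ring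

theorem map_vec (G : Point T D →ₗ[ℝ] ℝ) (d : D) (u v : T) (l : List T) :
    G (Tour.vec ⟨d, u, l ++ [v]⟩, 0) = G (edgeInd s(.inr d, .inl u), 0) +
      chain G u (l ++ [v]) + G (edgeInd s(.inr d, .inl v), 0) := by
  have hadd : ∀ x y : Edge T D → ℝ, G (x + y, 0) = G (x, 0) + G (y, 0) := by
    intro x y; rw [← map_add]; simp
  simp only [Tour.vec, hadd, map_walk, add_assoc]

theorem map_vec_single (G : Point T D →ₗ[ℝ] ℝ) (d : D) (u : T) :
    G (Tour.vec ⟨d, u, []⟩, 0) = 2 * G (edgeInd s(.inr d, .inl u), 0) := by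
  have hadd : ∀ x y : Edge T D → ℝ, G (x + y, 0) = G (x, 0) + G (y, 0) := by
    intro x y; rw [← map_add]; simp
  have : s((.inl u : T ⊕ D), .inr d) = s(.inr d, .inl u) := Sym2.eq_swap
  simp only [Tour.vec, hadd, walk, this]
  ring

end Face

/-! ### Vanishing of the edge coefficients. -/

section Coefficients

variable {T D : Type*} [Fintype T] [Fintype D] [DecidableEq T] [DecidableEq D]
  {C : Finpartition (Finset.univ : Finset T)} {D' : Finset D} {S : Finset T} {i j k : T}
  {d₀ : D} {G : Point T D →ₗ[ℝ] ℝ} {c : ℝ}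

/-- The list `l` enumerates the elements of `S` without repetition. -/
def Enumerates (l : List T) (S : Finset T) : Prop := l.Nodup ∧ ∀ v, v ∈ l ↔ v ∈ S

theorem enumerates_cons_erase {s : T} (hs : s ∈ S) : Enumerates (s :: (S.erase s).toList) S := by
  refine ⟨by simp [Finset.nodup_toList], fun v => ?_⟩
  by_cases h : v = s <;> simp [h, hs]

theorem Enumerates.perm {l l' : List T} (h : Enumerates l S) (hl : l'.Perm l) :
    Enumerates l' S := ⟨hl.nodup_iff.2 h.1, fun v => hl.mem_iff.trans (h.2 v)⟩

theorem exists_enumerates_concat {s : T} (hs : s ∈ S) : ∃ l, Enumerates (l ++ [s]) S :=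
  ⟨_, (enumerates_cons_erase hs).perm (List.perm_append_singleton _ _)⟩

theorem exists_enumerates_concat_concat {s t : T} (hs : s ∈ S) (ht : t ∈ S) (hst : s ≠ t) :
    ∃ l, Enumerates (l ++ [s] ++ [t]) S := by
  obtain ⟨l, hl⟩ := exists_enumerates_concat (S := S.erase t) (Finset.mem_erase.2 ⟨hst, hs⟩)
  refine ⟨l, (enumerates_cons_erase ht).perm
    ((List.perm_append_singleton _ _).trans (List.Perm.cons _ ?_))⟩
  rw [List.perm_ext_iff_of_nodup hl.1 (Finset.nodup_toList _)]
  simpa using hl.2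

namespace IsFaceFunctional

/-- The value of a tour from `D'` through all of `S ∪ {j, k}` that starts with `j` and may then go
on outside, with further tours outside `S ∪ {j, k}`. -/
theorem full_tour (hG : IsFaceFunctional C D' S i j k d₀ G c) {d : D} (hd : d ∈ D')
    {h l m : List T} {L : List (Tour T D)} (hS : Enumerates h S) (hl : l.Perm (k :: h))
    (hm : ∀ v ∈ m ++ visits L, v ∉ S ∪ {j, k}) (hmnd : (m ++ visits L).Nodup) :
    G (Tour.vec ⟨d, j, l ++ m⟩, 0) + (L.map fun t => G (t.vec, 0)).sum
      = c - ∑ v, G (0, Pi.single v 1) := by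
  have hmem : ∀ v, v ∈ j :: l ↔ v ∈ S ∪ {j, k} := by
    intro v
    rw [List.mem_cons, hl.mem_iff, List.mem_cons, hS.2]
    simp only [Finset.mem_union, Finset.mem_insert, Finset.mem_singleton]
    tauto
  have hnd : (j :: l).Nodup := by
    rw [List.nodup_cons, hl.nodup_iff, hl.mem_iff, List.nodup_cons, List.mem_cons, hS.2, hS.2]
    exact ⟨by have := hG.ne; have := hG.left; tauto, hG.right, hS.1⟩
  rw [eq_sub_iff_add_eq]
  refine hG.one_tour hd (fun K hK => ?_) (fun _ => Finset.mem_univ _) ?_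
    (fun v hv => (hmem v).1 (List.mem_cons_of_mem _ hv)) hm ?_ (fun _ _ => Finset.mem_univ _)
    fun v _ hv => (hmem v).2 hv
  · obtain ⟨v, hv⟩ := C.nonempty_of_mem_parts hK
    exact ⟨v, hv, Finset.mem_univ _⟩
  · rintro rfl
    simpa using hl.length_eq
  · rw [List.nodup_append]
    refine ⟨hnd, hmnd, ?_⟩
    rintro a ha b hb rfl
    exact hm a hb ((hmem a).1 ha)

theorem full_path (hG : IsFaceFunctional C D' S i j k d₀ G c) {d : D} (hd : d ∈ D')
    {h l : List T} {w : T} (hS : Enumerates h S) (hl : (l ++ [w]).Perm (k :: h)) :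
    G (edgeInd s(.inr d, .inl j), 0) + chain G j (l ++ [w]) + G (edgeInd s(.inr d, .inl w), 0)
      = c - ∑ v, G (0, Pi.single v 1) := by
  have := hG.full_tour hd (m := []) (L := []) hS hl (by simp [visits]) (by simp [visits])
  simpa [map_vec] using this

/-- Two tours that together cover `S ∪ {j, k}`. -/
theorem split_path (hG : IsFaceFunctional C D' S i j k d₀ G c) {d e : D} (hd : d ∈ D')
    (he : e ∉ D') {l : List T} {w : T} (hS : Enumerates (l ++ [w]) S) :
    2 * G (edgeInd s(.inr d, .inl j), 0) + (G (edgeInd s(.inr e, .inl k), 0)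
      + chain G k (l ++ [w]) + G (edgeInd s(.inr e, .inl w), 0))
      = c - ∑ v, G (0, Pi.single v 1) := by
  have := hG.two_tours hd he (m := []) (by simp) hS.1 hS.2 (by simp) (by simp)
  rw [eq_sub_iff_add_eq]
  simpa [map_vec, map_vec_single] using this

/-- All tour systems used visit every target, so the visit coefficients contribute the same constant
and the edge coefficients form a linear system with common right-hand side `K`. -/
theorem edge_eq_zero (hG : IsFaceFunctional C D' S i j k d₀ G c) (hd₀ : d₀ ∈ D') {e₀ : D}
    (he₀ : e₀ ∉ D') (h₀ : ∀ v, G (edgeInd s(.inr d₀, .inl v), 0) = 0)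
    (h₁ : G (edgeInd s(.inr e₀, .inl j), 0) = 0) (q : Sym2 (T ⊕ D)) : G (edgeInd q, 0) = 0 := by
  set K := c - ∑ v, G (0, Pi.single v 1) with hK
  have hjk := hG.ne
  have hj := hG.left
  have hk := hG.right
  have hi := hG.inner
  have hsymm : ∀ a b : T, G (edgeInd s(.inl a, .inl b), 0) = G (edgeInd s(.inl b, .inl a), 0) :=
    fun a b => by rw [Sym2.eq_swap]
  -- The six families of tours on `S ∪ {j, k}`, for a path `l ++ [s]` through `S`.
  have A₁ : ∀ d ∈ D', ∀ e ∉ D', ∀ l s, Enumerates (l ++ [s]) S →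
      2 * G (edgeInd s(.inr d, .inl j), 0) + (G (edgeInd s(.inr e, .inl k), 0)
        + chain G k (l ++ [s]) + G (edgeInd s(.inr e, .inl s), 0)) = K :=
    fun d hd e he l s hl => hG.split_path hd he hl
  have A₂ : ∀ d ∈ D', ∀ e ∉ D', ∀ l s, Enumerates (l ++ [s]) S →
      2 * G (edgeInd s(.inr e, .inl k), 0) + (G (edgeInd s(.inr d, .inl j), 0)
        + chain G j (l ++ [s]) + G (edgeInd s(.inr d, .inl s), 0)) = K :=
    fun d hd e he l s hl =>
      hG.swap.split_path (Finset.mem_compl.2 he) (by simpa using hd) hl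
  have B₁ : ∀ d ∈ D', ∀ l s, Enumerates (l ++ [s]) S →
      G (edgeInd s(.inr d, .inl j), 0) + (chain G j (l ++ [s])
        + G (edgeInd s(.inl s, .inl k), 0)) + G (edgeInd s(.inr d, .inl k), 0) = K := by
    intro d hd l s hl
    have := hG.full_path hd hl (l := l ++ [s]) (w := k)
      (List.perm_append_singleton _ _)
    rwa [List.append_assoc, List.singleton_append, chain_append, chain, chain, add_zero] at this
  have B₂ : ∀ e ∉ D', ∀ l s, Enumerates (l ++ [s]) S →
      G (edgeInd s(.inr e, .inl k), 0) + (chain G k (l ++ [s])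
        + G (edgeInd s(.inl s, .inl j), 0)) + G (edgeInd s(.inr e, .inl j), 0) = K := by
    intro e he l s hl
    have := hG.swap.full_path (Finset.mem_compl.2 he) hl (l := l ++ [s]) (w := j)
      (List.perm_append_singleton _ _)
    rwa [List.append_assoc, List.singleton_append, chain_append, chain, chain, add_zero] at this
  have C₁ : ∀ d ∈ D', ∀ l s, Enumerates (l ++ [s]) S →
      G (edgeInd s(.inr d, .inl j), 0) + (G (edgeInd s(.inl j, .inl k), 0)
        + chain G k (l ++ [s])) + G (edgeInd s(.inr d, .inl s), 0) = K := by
    intro d hd l s hl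
    exact hG.full_path hd hl (l := k :: l) (w := s) (List.Perm.refl _)
  have C₂ : ∀ e ∉ D', ∀ l s, Enumerates (l ++ [s]) S →
      G (edgeInd s(.inr e, .inl k), 0) + (G (edgeInd s(.inl k, .inl j), 0)
        + chain G j (l ++ [s])) + G (edgeInd s(.inr e, .inl s), 0) = K := by
    intro e he l s hl
    exact hG.swap.full_path (Finset.mem_compl.2 he) hl (l := j :: l) (w := s) (List.Perm.refl _)
  obtain ⟨l₀, hl₀⟩ := exists_enumerates_concat hi
  -- Changing only the depot on one side of the partition, in each family in turn, shows that these
  -- depot coefficients do not depend on the depot within its side.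
  have dj : ∀ d ∈ D', G (edgeInd s(.inr d, .inl j), 0) = 0 := by
    intro d hd
    have e1 := A₁ d hd e₀ he₀ l₀ i hl₀
    have e2 := A₁ d₀ hd₀ e₀ he₀ l₀ i hl₀
    linarith [h₀ j]
  have ek : ∀ e ∉ D', G (edgeInd s(.inr e, .inl k), 0) = G (edgeInd s(.inr e₀, .inl k), 0) := by
    intro e he
    have e1 := A₂ d₀ hd₀ e he l₀ i hl₀
    have e2 := A₂ d₀ hd₀ e₀ he₀ l₀ i hl₀
    linarith
  have ej : ∀ e ∉ D', G (edgeInd s(.inr e, .inl j), 0) = 0 := by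
    intro e he
    have e1 := B₂ e he l₀ i hl₀
    have e2 := B₂ e₀ he₀ l₀ i hl₀
    linarith [ek e he]
  have dk : ∀ d ∈ D', G (edgeInd s(.inr d, .inl k), 0) = 0 := by
    intro d hd
    have e1 := B₁ d hd l₀ i hl₀
    have e2 := B₁ d₀ hd₀ l₀ i hl₀
    linarith [h₀ k, h₀ j, dj d hd]
  have ds : ∀ d ∈ D', ∀ s ∈ S, G (edgeInd s(.inr d, .inl s), 0) = 0 := by
    intro d hd s hs
    obtain ⟨l, hl⟩ := exists_enumerates_concat hs
    have e1 := C₁ d hd l s hl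
    have e2 := C₁ d₀ hd₀ l s hl
    linarith [h₀ s, h₀ j, dj d hd]
  have sj : ∀ s ∈ S, ∀ e ∉ D',
      G (edgeInd s(.inl s, .inl j), 0) = G (edgeInd s(.inr e, .inl s), 0) := by
    intro s hs e he
    obtain ⟨l, hl⟩ := exists_enumerates_concat hs
    have e1 := A₁ d₀ hd₀ e he l s hl
    have e2 := B₂ e he l s hl
    linarith [h₀ j, ej e he]
  have sk : ∀ s ∈ S, G (edgeInd s(.inl s, .inl k), 0) = 2 * G (edgeInd s(.inr e₀, .inl k), 0) := by
    intro s hs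
    obtain ⟨l, hl⟩ := exists_enumerates_concat hs
    have e1 := A₂ d₀ hd₀ e₀ he₀ l s hl
    have e2 := B₁ d₀ hd₀ l s hl
    linarith [h₀ j, h₀ k, h₀ s]
  have jkτ : ∀ s ∈ S, G (edgeInd s(.inl s, .inl j), 0) = G (edgeInd s(.inl j, .inl k), 0) := by
    intro s hs
    have henum := enumerates_cons_erase hs
    -- The same path is read from both ends: its first target s is needed to separate the edges js
    -- and ks, its last target w for the return to the depot.
    obtain ⟨l, w, hlw⟩ : ∃ l w, s :: (S.erase s).toList = l ++ [w] :=
      (List.eq_nil_or_concat' _).resolve_left (by simp)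
    have hw : w ∈ S := (henum.2 w).1 (by rw [hlw]; simp)
    have cj : chain G j (l ++ [w]) =
        G (edgeInd s(.inl j, .inl s), 0) + chain G s (S.erase s).toList := by rw [← hlw]; rfl
    have ck : chain G k (l ++ [w]) =
        G (edgeInd s(.inl k, .inl s), 0) + chain G s (S.erase s).toList := by rw [← hlw]; rfl
    rw [hlw] at henum
    have e1 := A₂ d₀ hd₀ e₀ he₀ l w henum
    have e2 := C₁ d₀ hd₀ l w henum
    linarith [h₀ j, h₀ w, hsymm j s, hsymm k s, sk s hs]
  have hchain : ∀ l s, Enumerates (l ++ [s]) S →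
      chain G k (l ++ [s]) + G (edgeInd s(.inl j, .inl k), 0) = K := by
    intro l s hl
    linarith [C₁ d₀ hd₀ l s hl, h₀ j, h₀ s]
  have is := sj i hi e₀ he₀
  have iτ := jkτ i hi
  -- The coefficients of e₀i, ij and jk now agree, so `A₁` against `C₁` isolates the edge e₀k; next,
  -- `A₂` against `C₂` leaves twice the coefficient of jk.
  have ek₀ : G (edgeInd s(.inr e₀, .inl k), 0) = 0 := by
    linarith [A₁ d₀ hd₀ e₀ he₀ l₀ i hl₀, hchain l₀ i hl₀, h₀ j]
  have hjk₀ : G (edgeInd s(.inl j, .inl k), 0) = 0 := by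
    linarith [A₂ d₀ hd₀ e₀ he₀ l₀ i hl₀, C₂ e₀ he₀ l₀ i hl₀, h₀ j, h₀ i, hsymm j k]
  have sj₀ : ∀ s ∈ S, G (edgeInd s(.inl s, .inl j), 0) = 0 := fun s hs => by rw [jkτ s hs, hjk₀]
  have sk₀ : ∀ s ∈ S, G (edgeInd s(.inl s, .inl k), 0) = 0 := fun s hs => by
    rw [sk s hs, ek₀, mul_zero]
  have es : ∀ e ∉ D', ∀ s ∈ S, G (edgeInd s(.inr e, .inl s), 0) = 0 := fun e he s hs => by
    rw [← sj s hs e he, sj₀ s hs]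
  have hjchain : ∀ l s, Enumerates (l ++ [s]) S →
      chain G j (l ++ [s]) = K := by
    intro l s hl
    linarith [A₂ d₀ hd₀ e₀ he₀ l s hl, h₀ j, h₀ s]
  have hkchain : ∀ l s, Enumerates (l ++ [s]) S →
      chain G k (l ++ [s]) = K := by
    intro l s hl
    linarith [hchain l s hl]
  have ss : ∀ s ∈ S, ∀ t ∈ S, s ≠ t → G (edgeInd s(.inl s, .inl t), 0) = 0 := by
    intro s hs t ht hst
    obtain ⟨r, hr⟩ := exists_enumerates_concat_concat hs ht hst
    have e1 := hjchain (r ++ [s]) t hr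
    -- Inserting k between s and t replaces st by sk and kt, whose coefficients are already zero.
    have e2 := hG.full_path hd₀ hr (l := r ++ [s] ++ [k]) (w := t) (by
      rw [List.append_assoc _ [k]]; exact List.perm_middle)
    rw [List.append_assoc, List.singleton_append, chain_append, chain, chain] at e1
    rw [List.append_assoc, List.append_assoc, List.singleton_append, List.singleton_append,
      chain_append, chain, chain, chain] at e2
    linarith [h₀ j, h₀ t, sk₀ s hs, sk₀ t ht, hsymm k t]
  have outer : ∀ v, v ∉ S ∪ {j, k} → ∀ d, G (edgeInd s(.inr d, .inl v), 0) = 0 := by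
    intro v hv d
    have e1 := hG.full_tour hd₀ (l := l₀ ++ [i] ++ [k]) (m := []) (L := [⟨d, v, []⟩])
      hl₀ (List.perm_append_singleton _ _) (by simpa [visits, Tour.targets] using hv)
      (by simp [visits, Tour.targets])
    simp only [List.append_nil, map_vec, List.map_cons, List.map_nil, List.sum_cons,
      List.sum_nil, map_vec_single] at e1
    rw [List.append_assoc, List.singleton_append, chain_append, chain, chain] at e1
    linarith [B₁ d₀ hd₀ l₀ i hl₀]
  have outer₂ : ∀ u, u ∉ S ∪ {j, k} → ∀ v, v ∉ S ∪ {j, k} → u ≠ v →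
      G (edgeInd s(.inl u, .inl v), 0) = 0 := by
    intro u hu v hv huv
    have e1 := hG.full_tour hd₀ (l := l₀ ++ [i] ++ [k]) (m := []) (L := [⟨d₀, u, [] ++ [v]⟩])
      hl₀ (List.perm_append_singleton _ _) (by
          simp only [visits, Tour.targets, List.flatMap_cons, List.flatMap_nil, List.nil_append,
            List.append_nil, List.mem_cons, List.not_mem_nil, or_false]
          rintro w (rfl | rfl) <;> assumption) (by simp [visits, Tour.targets, huv])
    simp only [List.append_nil, map_vec, List.map_cons, List.map_nil, List.sum_cons,
      List.sum_nil] at e1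
    rw [List.append_assoc, List.singleton_append, chain_append, chain, chain, List.nil_append,
      chain, chain] at e1
    linarith [B₁ d₀ hd₀ l₀ i hl₀, h₀ u, h₀ v]
  have kv : ∀ v, v ∉ S ∪ {j, k} → G (edgeInd s(.inl k, .inl v), 0) = 0 := by
    intro v hv
    have e1 := hG.full_tour hd₀ (l := l₀ ++ [i] ++ [k]) (m := [v]) (L := [])
      hl₀ (List.perm_append_singleton _ _) (by simpa [visits] using hv) (by simp [visits])
    simp only [map_vec, List.map_nil, List.sum_nil] at e1
    rw [List.append_assoc, List.append_assoc, List.singleton_append, List.singleton_append,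
      chain_append, chain, chain, chain] at e1
    linarith [B₁ d₀ hd₀ l₀ i hl₀, h₀ k, h₀ v]
  have jv : ∀ v, v ∉ S ∪ {j, k} → G (edgeInd s(.inl j, .inl v), 0) = 0 := by
    intro v hv
    -- To leave S ∪ {j, k} from j, the tour must start with k, hence at a depot outside D'.
    have e1 := hG.swap.full_tour (Finset.mem_compl.2 he₀) (l := l₀ ++ [i] ++ [j]) (m := [v])
      (L := []) hl₀ (List.perm_append_singleton _ _) (by rw [Finset.pair_comm]; simpa [visits] using hv)
      (by simp [visits])
    simp only [map_vec, List.map_nil, List.sum_nil] at e1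
    rw [List.append_assoc, List.append_assoc, List.singleton_append, List.singleton_append,
      chain_append, chain, chain, chain] at e1
    linarith [B₂ e₀ he₀ l₀ i hl₀, outer v hv e₀, h₁]
  have sv : ∀ s ∈ S, ∀ v, v ∉ S ∪ {j, k} → G (edgeInd s(.inl s, .inl v), 0) = 0 := by
    intro s hs v hv
    obtain ⟨l, hl⟩ := exists_enumerates_concat hs
    have e1 := hG.two_tours hd₀ he₀ (m := [v]) (by simp) hl.1 hl.2 (by simpa using hv) (by simp)
    rw [← eq_sub_iff_add_eq, ← hK, map_vec, map_vec_single, List.append_assoc,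
      List.singleton_append, chain_append, chain, chain] at e1
    linarith [hkchain l s hl, h₀ j, outer v hv e₀]
  have hloop : ∀ a : T, G (edgeInd s(.inl a, .inl a), 0) = 0 := fun a => by
    rw [edgeInd_eq_zero (by simp)]; exact map_zero G
  have hdepot : ∀ d v, G (edgeInd s(.inr d, .inl v), 0) = 0 := by
    intro d v
    by_cases hv : v ∈ S ∪ {j, k}
    · rw [Finset.mem_union, Finset.mem_insert, Finset.mem_singleton] at hv
      by_cases hd : d ∈ D'
      · rcases hv with hv | rfl | rfl
        exacts [ds d hd v hv, dj d hd, dk d hd]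
      · rcases hv with hv | rfl | rfl
        exacts [es d hd v hv, ej d hd, (ek d hd).trans ek₀]
    · exact outer v hv d
  have hinner : ∀ a ∈ S ∪ {j, k}, ∀ b, G (edgeInd s(.inl a, .inl b), 0) = 0 := by
    intro a ha b
    by_cases hb : b ∈ S ∪ {j, k}
    · rw [Finset.mem_union, Finset.mem_insert, Finset.mem_singleton] at ha hb
      rcases ha with ha | rfl | rfl <;> rcases hb with hb | rfl | rfl
      · by_cases hab : a = b
        · rw [hab]; exact hloop b
        · exact ss a ha b hb hab
      · exact sj₀ a ha
      · exact sk₀ a ha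
      · exact (hsymm _ _).trans (sj₀ b hb)
      · exact hloop _
      · exact hjk₀
      · exact (hsymm _ _).trans (sk₀ b hb)
      · exact (hsymm _ _).trans hjk₀
      · exact hloop _
    · rw [Finset.mem_union, Finset.mem_insert, Finset.mem_singleton] at ha
      rcases ha with ha | rfl | rfl
      exacts [sv a ha b hb, jv b hb, kv b hb]
  induction q with
  | h x y =>
    rcases x with a | d <;> rcases y with b | e
    · by_cases ha : a ∈ S ∪ {j, k}
      · exact hinner a ha b
      · by_cases hb : b ∈ S ∪ {j, k}
        · exact (hsymm a b).trans (hinner b hb a)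
        · by_cases hab : a = b
          · rw [hab]; exact hloop b
          · exact outer₂ a ha b hb hab
    · rw [Sym2.eq_swap]; exact hdepot e a
    · exact hdepot d b
    · rw [edgeInd_eq_zero (by simp)]; exact map_zero G

end IsFaceFunctional

end Coefficients

/-! ### Visit coefficients, directions of P and the dimension count. -/

section Facet

variable {T D : Type*} [Fintype T] [Fintype D] [DecidableEq T] [DecidableEq D]
  {C : Finpartition (Finset.univ : Finset T)} {D' : Finset D} {S : Finset T} {i j k : T}
  {d₀ : D} {G : Point T D →ₗ[ℝ] ℝ} {c : ℝ}

theorem map_fst_eq_zero (hG : ∀ q, G (edgeInd q, 0) = 0) (x : Edge T D → ℝ) : G (x, 0) = 0 := by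
  classical
  have hx : (x, (0 : T → ℝ)) = ∑ e : Edge T D, x e • (edgeInd e.1, (0 : T → ℝ)) := by
    rw [Prod.ext_iff]
    constructor
    · funext e
      simp [Prod.fst_sum, Finset.sum_apply, edgeInd, Subtype.coe_inj]
    · simp [Prod.snd_sum]
  rw [hx, map_sum]
  exact Finset.sum_eq_zero fun e _ => by rw [map_smul, hG, smul_zero]

namespace IsFaceFunctional

/-- If `v` may be skipped, without making the coefficient of `i` drop, its coefficient is zero. -/
theorem visit_eq_zero_of_ne (hG : IsFaceFunctional C D' S i j k d₀ G c) (hd₀ : d₀ ∈ D')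
    (h₀ : ∀ q, G (edgeInd q, 0) = 0) {v : T} (hv : {v} ∉ C.parts) (hvj : v ≠ j)
    (hvi : mu C S = 0 → v ≠ i) : G (0, Pi.single v 1) = 0 := by
  have hjk := hG.ne
  have hj := hG.left
  have hk := hG.right
  have hi := hG.inner
  obtain ⟨l, hl⟩ := exists_enumerates_concat hi
  have hall := hG.full_tour hd₀ hl (List.Perm.refl _) (m := []) (L := []) (by simp [visits])
    (by simp [visits])
  have hdrop := hG.one_tour hd₀ (U := Finset.univ.erase v) (l := ((insert k S).erase v).toList)
    (m := []) (L := [])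
    (fun K hK => by
      by_contra! h
      apply hv
      have : K = {v} := by
        refine Finset.eq_singleton_iff_nonempty_unique_mem.2 ⟨C.nonempty_of_mem_parts hK, ?_⟩
        intro u hu
        by_contra hne
        exact h u hu (by simp [hne])
      rwa [← this])
    (fun hm => by simp [(hvi hm).symm])
    -- A target besides j must remain, as otherwise the tour would have slack 0: k remains unless it
    -- is the dropped target, and then i does.
    (by
      rw [ne_eq, Finset.toList_eq_nil, ← ne_eq, ← Finset.nonempty_iff_ne_empty]
      by_cases h : v = k
      · exact ⟨i, by subst h; simp [hi]; rintro rfl; exact hk hi⟩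
      · exact ⟨k, by simp [Ne.symm h]⟩)
    (fun u hu => by simp at hu ⊢; tauto) (by simp [visits])
    (by simp [visits, Finset.nodup_toList, hjk, hj])
    (fun u hu => by
      simp [visits] at hu ⊢
      rcases hu with rfl | hu
      · exact hvj.symm
      · exact hu.1)
    (fun u hu hu' => by simp at hu hu' ⊢; tauto)
  rw [map_fst_eq_zero h₀] at hall hdrop
  simp only [List.map_nil, List.sum_nil, zero_add, add_zero] at hall hdrop
  rw [← Finset.add_sum_erase _ _ (Finset.mem_univ v)] at hall
  linarith

theorem visit_eq_zero (hG : IsFaceFunctional C D' S i j k d₀ G c) (hd₀ : d₀ ∈ D') {e₀ : D}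
    (he₀ : e₀ ∉ D') (h₀ : ∀ q, G (edgeInd q, 0) = 0) {v : T} (hv : {v} ∉ C.parts) :
    G (0, Pi.single v 1) = 0 := by
  have hjk := hG.ne
  have hj := hG.left
  have hk := hG.right
  have hi := hG.inner
  have hij : i ≠ j := by rintro rfl; exact hj hi
  by_cases hvj : v = j
  · subst hvj
    -- The tour omitting j starts with k and needs a depot outside D'. The base depot may be changed
    -- to e₀ since all edge coefficients vanish.
    exact ({ hG.swap with outside := fun _ _ => h₀ _ } :
      IsFaceFunctional C D'ᶜ S i k v e₀ G c).visit_eq_zero_of_ne (Finset.mem_compl.2 he₀) h₀ hv hjk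
      fun _ => hij.symm
  by_cases hvi : mu C S = 0 → v ≠ i
  · exact hG.visit_eq_zero_of_ne hd₀ h₀ hv hvj hvi
  push Not at hvi
  obtain ⟨hm, rfl⟩ := hvi
  have hsub : ∀ K ∈ C.parts, ¬ K ⊆ S := by
    simpa [mu, Finset.filter_eq_empty_iff] using hm
  obtain ⟨l, hl⟩ := exists_enumerates_concat hi
  have hall := hG.full_tour hd₀ hl (List.Perm.refl _) (m := []) (L := []) (by simp [visits])
    (by simp [visits])
  have hvis : visits [⟨d₀, j, []⟩, ⟨e₀, k, []⟩] = [j, k] := rfl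
  -- When μ(S) = 0 and i is dropped, equality requires slack 0. Hence all of S is skipped and j, k
  -- are visited alone from opposite sides. The other coefficients on S are already known to be
  -- zero.
  have hdrop := hG.sum_eq (L := [⟨d₀, j, []⟩, ⟨e₀, k, []⟩]) (U := Sᶜ)
    (by rw [hvis]; simp [hjk]) (by rw [hvis]; simp [hj, hk]) (by rw [hvis]; simp; tauto)
    (fun K hK => by
      obtain ⟨u, hu, huS⟩ := Finset.not_subset.1 (hsub K hK)
      exact ⟨u, hu, Finset.mem_compl.2 huS⟩)
    (by
      rw [if_pos ⟨hm, by simpa using hi⟩]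
      simp only [List.map_cons, List.map_nil, List.sum_cons, List.sum_nil]
      rw [slack_vec_single hd₀ hjk, ← slack_swap,
        slack_vec_single (Finset.mem_compl.2 he₀) hjk.symm]
      simp)
  simp only [map_fst_eq_zero h₀, List.map_nil, List.map_cons, List.sum_cons, List.sum_nil, zero_add,
    add_zero] at hall hdrop
  rw [← Finset.sum_add_sum_compl S, Finset.sum_eq_single_of_mem v hi] at hall
  · linarith
  · intro u hu huv
    refine hG.visit_eq_zero_of_ne hd₀ h₀ (fun h => ?_) (by rintro rfl; exact hj hu) fun _ => huv
    exact hsub _ h (by simpa using hu)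

end IsFaceFunctional

/-- The map `(x, y) ↦ x(F)`. -/
def totalMap (F : Finset (Edge T D)) : Point T D →ₗ[ℝ] ℝ where
  toFun p := total p.1 F
  map_add' _ _ := total_add _ _ _
  map_smul' _ _ := total_smul _ _ _

/-- The map `(x, y) ↦ y_v`. -/
def visitMap (v : T) : Point T D →ₗ[ℝ] ℝ := LinearMap.proj v ∘ₗ LinearMap.snd ℝ _ _

/-- The difference of the two sides of a degree equation. -/
def degreeMap (v : T) : Point T D →ₗ[ℝ] ℝ := totalMap (delta (tgt {v})) - (2 : ℝ) • visitMap v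

/-- The linear part of the left-hand side of the path inequality. -/
def pathMap (C : Finpartition (Finset.univ : Finset T)) (D' : Finset D) (S : Finset T)
    (i j k : T) : Point T D →ₗ[ℝ] ℝ :=
  totalMap (between (dep D') (tgt {j})) + (2 : ℝ) • totalMap (gamma (tgt (S ∪ {j, k})))
    + totalMap (between (tgt {k}) (dep D'ᶜ)) - ∑ v, beta C S i j k v • visitMap v

theorem pathLHS_eq_pathMap (p : Point T D) : pathLHS C D' S i j k p =
    pathMap C D' S i j k p + ∑ v, beta C S i j k v := by
  simp only [pathLHS, pathMap, LinearMap.sub_apply, LinearMap.add_apply, LinearMap.smul_apply,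
    LinearMap.sum_apply, totalMap, visitMap, LinearMap.coe_mk, AddHom.coe_mk, mul_sub, mul_one,
    Finset.sum_sub_distrib, smul_eq_mul, LinearMap.comp_apply, LinearMap.snd_apply,
    LinearMap.proj_apply]
  ring

theorem degreeMap_edgeInd (u v : T) (d : D) :
    degreeMap u (edgeInd s(.inr d, .inl v), 0) = if v = u then (1 : ℝ) else 0 := by
  simp only [degreeMap, totalMap, visitMap, LinearMap.sub_apply, LinearMap.smul_apply,
    LinearMap.coe_mk, AddHom.coe_mk, LinearMap.comp_apply, LinearMap.snd_apply,
    LinearMap.proj_apply, Pi.zero_apply, smul_zero, sub_zero]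
  rw [total_edgeInd_delta]
  simp

theorem pathMap_edgeInd (v : T) (d : D) :
    pathMap C D' S i j k (edgeInd s(.inr d, .inl v), 0) =
      (if v = j ∧ d ∈ D' then 1 else 0) + if v = k ∧ d ∉ D' then 1 else 0 := by
  have h : s((.inr d : T ⊕ D), .inl v) ∈ (graph T D).edgeSet := by simp
  simp only [pathMap, totalMap, visitMap, LinearMap.sub_apply, LinearMap.smul_apply,
    LinearMap.add_apply, LinearMap.sum_apply,
    LinearMap.coe_mk, AddHom.coe_mk, LinearMap.comp_apply, LinearMap.snd_apply,
    LinearMap.proj_apply, Pi.zero_apply, smul_zero, sub_zero, Finset.sum_const_zero,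
    total_edgeInd h, mem_between, mem_gamma]
  simp [and_comm]

theorem eq_zero_of_mem_vectorSpan {P : Set (Point T D)} {f : Point T D →ₗ[ℝ] ℝ} {a : ℝ}
    (hf : ∀ p ∈ P, f p = a) {z : Point T D} (hz : z ∈ vectorSpan ℝ P) : f z = 0 := by
  have h : vectorSpan ℝ P ≤ LinearMap.ker f := by
    refine Submodule.span_le.2 ?_
    rintro _ ⟨p, hp, q, hq, rfl⟩
    simp [hf p hp, hf q hq]
  exact h hz

theorem eq_zero_of_mem_vectorSpan_convexHull {P : Set (Point T D)} {f : Point T D →ₗ[ℝ] ℝ} {a : ℝ}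
    (hf : ∀ p ∈ P, f p = a) {z : Point T D} (hz : z ∈ vectorSpan ℝ (convexHull ℝ P)) :
    f z = 0 := by
  refine eq_zero_of_mem_vectorSpan (a := a) (fun p hp => ?_) hz
  exact convexHull_min (t := f ⁻¹' {a}) hf ((convex_singleton a).linear_preimage f) hp

/-- A direction of `P` along the hyperplane of the path inequality is a direction of the face. -/
theorem mem_vectorSpan_face (hD'ne : D'.Nonempty) (hD' : D' ⊂ Finset.univ) (hjk : j ≠ k)
    (hj : j ∉ S) (hk : k ∉ S) (hi : i ∈ S) (hne : (face C D' S i j k).Nonempty) {z : Point T D}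
    (hz : z ∈ vectorSpan ℝ (polytope D C)) (hz0 : pathMap C D' S i j k z = 0) :
    z ∈ vectorSpan ℝ (face C D' S i j k) := by
  obtain ⟨d₀, hd₀⟩ := hD'ne
  obtain ⟨e₀, -, he₀⟩ := Finset.exists_of_ssubset hD'
  obtain ⟨p₀, hp₀⟩ := hne
  by_contra hzF
  obtain ⟨G, hGz, hGF⟩ := Submodule.exists_le_ker_of_notMem hzF
  apply hGz
  have hconst : ∀ p ∈ face C D' S i j k, G p = G p₀ := by
    intro p hp
    have := hGF (vsub_mem_vectorSpan ℝ hp hp₀)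
    rwa [LinearMap.mem_ker, vsub_eq_sub, map_sub, sub_eq_zero] at this
  have hdegP : ∀ v, ∀ p ∈ {p : Point T D | IsFeasible C p}, degreeMap v p = 0 := by
    intro v p hp
    have := IsRelaxedSolution.degree (IsFeasible.toIsRelaxedSolution hp) v
    simp [degreeMap, totalMap, visitMap, this]
  have hdeg : ∀ v, ∀ p ∈ polytope D C, degreeMap v p = 0 := fun v p hp =>
    convexHull_min (t := degreeMap v ⁻¹' {0}) (hdegP v)
      ((convex_singleton 0).linear_preimage (degreeMap v)) hp
  -- At j the multiplier is read off e₀j, which has coefficient 0 in the path inequality. The edge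
  -- d₀j has coefficient 1 there, so κ can then clear it.
  set lam : T → ℝ := fun v => G (edgeInd s(.inr (if v = j then e₀ else d₀), .inl v), 0) with hlam
  set κ : ℝ := G (edgeInd s(.inr d₀, .inl j), 0) - lam j with hκ
  set H : Point T D →ₗ[ℝ] ℝ := G - ∑ v, lam v • degreeMap v - κ • pathMap C D' S i j k with hH
  have hHapp : ∀ p, H p = G p - ∑ v, lam v * degreeMap v p - κ * pathMap C D' S i j k p := by
    intro p
    simp [hH, LinearMap.sum_apply]
  have hHd : ∀ d v, H (edgeInd s(.inr d, .inl v), 0) = G (edgeInd s(.inr d, .inl v), 0) - lam v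
      - κ * ((if v = j ∧ d ∈ D' then 1 else 0) + if v = k ∧ d ∉ D' then 1 else 0) := by
    intro d v
    rw [hHapp, pathMap_edgeInd]
    simp [degreeMap_edgeInd]
  have h₀ : ∀ v, H (edgeInd s(.inr d₀, .inl v), 0) = 0 := by
    intro v
    rw [hHd]
    by_cases hv : v = j
    · subst hv; simp [hd₀, hκ]
    · simp [hv, hd₀, hlam]
  have hface : IsFaceFunctional C D' S i j k d₀ H (G p₀ - κ * pathMap C D' S i j k p₀) := by
    refine ⟨hjk, hj, hk, hi, fun p hp => ?_, fun v _ => h₀ v⟩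
    have h1 := hp.2
    have h2 := hp₀.2
    rw [pathLHS_eq_pathMap] at h1 h2
    have h3 : pathMap C D' S i j k p = pathMap C D' S i j k p₀ := by linarith
    rw [hHapp, hconst p hp, h3]
    simp [hdeg _ p hp.1]
  have hedge := hface.edge_eq_zero hd₀ he₀ h₀ (by rw [hHd]; simp [hjk, he₀, hlam])
  have hHz : H z = 0 := by
    have hz' : z = (z.1, 0) + (0, z.2) := by simp
    have hz'' : ((0 : Edge T D → ℝ), z.2) = ∑ v, z.2 v • (0, Pi.single v (1 : ℝ)) := by
      rw [Prod.ext_iff]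
      constructor
      · simp [Prod.fst_sum]
      · funext v
        simp [Prod.snd_sum, Finset.sum_apply, Pi.single_apply]
    rw [hz', map_add, map_fst_eq_zero hedge, zero_add, hz'', map_sum]
    refine Finset.sum_eq_zero fun v _ => ?_
    rw [map_smul]
    -- A singleton cluster forces y_v = 1 on P, so the direction z has no component at v; otherwise
    -- the coefficient of H is zero.
    by_cases hv : {v} ∈ C.parts
    · have : visitMap v z = 0 := by
        refine eq_zero_of_mem_vectorSpan_convexHull (a := 1) (fun p hp => ?_) hz
        have h1 := IsRelaxedSolution.cluster (IsFeasible.toIsRelaxedSolution hp) _ hv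
        rw [Finset.sum_singleton] at h1
        have h2 := IsRelaxedSolution.visit_le_one (IsFeasible.toIsRelaxedSolution hp) v
        exact le_antisymm h2 h1
      have hzv : z.2 v = 0 := this
      rw [hzv, zero_smul]
    · rw [hface.visit_eq_zero hd₀ he₀ hedge hv, smul_zero]
  rw [hHapp, hz0] at hHz
  have hdz : ∀ v, degreeMap v z = 0 := fun v => eq_zero_of_mem_vectorSpan (hdeg v) hz
  simpa [hdz] using hHz

theorem face_nonempty (hD'ne : D'.Nonempty) (hjk : j ≠ k) (hj : j ∉ S) (hk : k ∉ S) (hi : i ∈ S) :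
    (face C D' S i j k).Nonempty := by
  obtain ⟨d₀, hd₀⟩ := hD'ne
  by_contra hempty
  rw [Set.not_nonempty_iff_eq_empty] at hempty
  -- On an empty face the zero functional is vacuously constant with value 1; evaluating a full
  -- tour, which does lie on the face, yields 0 = 1.
  have hG : IsFaceFunctional C D' S i j k d₀ 0 1 :=
    ⟨hjk, hj, hk, hi, by simp [hempty], by simp⟩
  obtain ⟨l, hl⟩ := exists_enumerates_concat hi
  have := hG.full_tour hd₀ hl (List.Perm.refl _) (m := []) (L := []) (by simp [visits])
    (by simp [visits])
  simp at this

/-- Visiting every target alone from one depot of `D'` does not attain equality. -/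
theorem exists_mem_polytope_ne (hD'ne : D'.Nonempty) (hjk : j ≠ k) (hj : j ∉ S) (hk : k ∉ S)
    (hi : i ∈ S) : ∃ p ∈ polytope D C, pathLHS C D' S i j k p ≠ 2 * (S.card : ℝ) + 3 := by
  obtain ⟨d₀, hd₀⟩ := hD'ne
  have hv : visits (singles d₀ (Finset.univ : Finset T)) = Finset.univ.toList :=
    visits_singles _ _
  have hnd : (visits (singles d₀ (Finset.univ : Finset T))).Nodup := by
    rw [hv]; exact Finset.nodup_toList _
  have hC : ∀ K ∈ C.parts, ∃ v ∈ K, v ∈ visits (singles d₀ (Finset.univ : Finset T)) := by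
    intro K hK
    obtain ⟨v, hv'⟩ := C.nonempty_of_mem_parts hK
    exact ⟨v, hv', by simp [hv]⟩
  refine ⟨_, toursPoint_mem_polytope hnd hC, ?_⟩
  have hcard : ((S ∪ {j, k}).card : ℝ) = S.card + 2 := by
    rw [Finset.card_union_of_disjoint (by simp [hj, hk]), Finset.card_pair hjk]; push_cast; ring
  have hy : (toursPoint (singles d₀ (Finset.univ : Finset T))).2 i = 1 := by
    rw [toursPoint_snd hnd, if_pos (by simp [hv])]
  -- Every target of S ∪ {j, k} except j contributes 2, whereas equality would require slack 1
  -- because i is visited.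
  have hslack : slack D' S j k (toursPoint (singles d₀ (Finset.univ : Finset T))).1 =
      2 * ((S.card : ℝ) + 1) := by
    have hterm : ∀ v, slack D' S j k (Tour.vec ⟨d₀, v, []⟩) =
        2 * ((if v ∈ S ∪ {j, k} then 1 else 0) - if v = j then 1 else 0) := by
      intro v
      simp only [Tour.vec, walk]
      rw [slack_add, Sym2.eq_swap, slack_edgeInd_depot]
      simp only [hd₀, and_true, not_true, and_false, if_false]
      ring
    simp only [toursPoint]
    rw [slack_list_sum, singles, List.map_map]
    simp only [Function.comp_def, hterm]
    rw [Finset.sum_map_toList, ← Finset.mul_sum, Finset.sum_sub_distrib, Finset.sum_ite_mem]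
    simp only [Finset.univ_inter, Finset.sum_const, nsmul_eq_mul, mul_one, hcard,
      Finset.sum_ite_eq', Finset.mem_univ, if_true]
    ring
  rw [pathLHS_eq (toursPoint_isRouting hnd hC).toIsRelaxedSolution hjk hj hk hi, ← slack, hslack,
    hy]
  simp only [sub_self, ite_self]
  have : (0 : ℝ) ≤ S.card := by positivity
  intro h
  have h1 : (1 : ℝ) ≤ S.card := by exact_mod_cast Finset.card_pos.2 ⟨i, hi⟩
  linarith

/-- Inside A, the subspace B is the kernel of a non-zero functional, so it has codimension one. -/
theorem finrank_add_one_of_le_ker {E : Type*} [AddCommGroup E] [Module ℝ E] [FiniteDimensional ℝ E]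
    {A B : Submodule ℝ E} {f : E →ₗ[ℝ] ℝ} (hBA : B ≤ A) (hB : ∀ z ∈ A, z ∈ B ↔ f z = 0)
    (hf : ∃ z ∈ A, f z ≠ 0) : Module.finrank ℝ B + 1 = Module.finrank ℝ A := by
  have hker : LinearMap.ker (f.domRestrict A) = B.comap A.subtype := by
    ext z
    exact (hB z z.2).symm
  have hne : f.domRestrict A ≠ 0 := by
    obtain ⟨z, hz, h⟩ := hf
    exact fun h0 => h (DFunLike.congr_fun h0 (⟨z, hz⟩ : A))
  rw [← Module.Dual.finrank_ker_add_one_of_ne_zero hne, hker,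
    (Submodule.comapSubtypeEquivOfLe hBA).finrank_eq]

theorem pathLHS_isValid (hD' : D' ⊂ Finset.univ) (hjk : j ≠ k) (hj : j ∉ S) (hk : k ∉ S)
    (hi : i ∈ S) :
    IsValid (polytope D C) (pathLHS C D' S i j k) (2 * (S.card : ℝ) + 3) := by
  intro p hp
  have h : ∀ q ∈ {q : Point T D | IsFeasible C q},
      pathMap C D' S i j k q ≤ 2 * (S.card : ℝ) + 3 - ∑ v, beta C S i j k v := by
    intro q hq
    have := IsFeasible.pathLHS_le hq hD' hjk hj hk hi
    rw [pathLHS_eq_pathMap] at this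
    linarith
  have hle : pathMap C D' S i j k p ≤ 2 * (S.card : ℝ) + 3 - ∑ v, beta C S i j k v :=
    convexHull_min (t := {q | pathMap C D' S i j k q ≤ _}) h
      (convex_halfSpace_le (pathMap C D' S i j k).isLinear _) hp
  rw [pathLHS_eq_pathMap]
  linarith

theorem finrank_face (hD'ne : D'.Nonempty) (hD' : D' ⊂ Finset.univ) (hjk : j ≠ k)
    (hj : j ∉ S) (hk : k ∉ S) (hi : i ∈ S) :
    Module.finrank ℝ (vectorSpan ℝ (face C D' S i j k)) + 1 =
      Module.finrank ℝ (vectorSpan ℝ (polytope D C)) := by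
  have hne := face_nonempty (C := C) hD'ne hjk hj hk hi
  refine finrank_add_one_of_le_ker (f := pathMap C D' S i j k)
    (vectorSpan_mono ℝ fun p hp => hp.1) (fun z hz => ⟨fun h => ?_, fun h => ?_⟩) ?_
  · refine eq_zero_of_mem_vectorSpan
      (a := 2 * (S.card : ℝ) + 3 - ∑ v, beta C S i j k v) (fun p hp => ?_) h
    have := hp.2
    rw [pathLHS_eq_pathMap] at this
    linarith
  · exact mem_vectorSpan_face hD'ne hD' hjk hj hk hi hne hz h
  · obtain ⟨p, hp⟩ := hne
    obtain ⟨q, hq, hqne⟩ := exists_mem_polytope_ne (C := C) hD'ne hjk hj hk hi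
    refine ⟨q -ᵥ p, vsub_mem_vectorSpan ℝ hq hp.1, fun h => hqne ?_⟩
    rw [vsub_eq_sub, map_sub, sub_eq_zero] at h
    rw [← hp.2, pathLHS_eq_pathMap, pathLHS_eq_pathMap, h]

end Facet

end

end GMDTSP

theorem proposition6 {T D : Type*} [Fintype T] [Fintype D] [DecidableEq T] [DecidableEq D]
    (C : Finpartition (Finset.univ : Finset T))
    (D' : Finset D) (hD'ne : D'.Nonempty) (hD' : D' ⊂ Finset.univ)
    (S : Finset T) (i j k : T) (hjk : j ≠ k) (hj : j ∉ S) (hk : k ∉ S) (hi : i ∈ S) :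
    (∀ p : GMDTSP.Point T D, GMDTSP.IsRouting C p →
      GMDTSP.pathLHS C D' S i j k p ≤ 2 * (S.card : ℝ) + 3) ∧
    GMDTSP.IsValid (GMDTSP.polytope D C) (GMDTSP.pathLHS C D' S i j k) (2 * (S.card : ℝ) + 3) ∧
    GMDTSP.IsFacetDefining (GMDTSP.polytope D C) (GMDTSP.pathLHS C D' S i j k)
      (2 * (S.card : ℝ) + 3) := by
  have hvalid := GMDTSP.pathLHS_isValid (C := C) hD' hjk hj hk hi
  exact ⟨fun p hp => hp.isFeasible.pathLHS_le hD' hjk hj hk hi, hvalid, hvalid,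
    GMDTSP.face_nonempty hD'ne hjk hj hk hi, GMDTSP.finrank_face hD'ne hD' hjk hj hk hi⟩
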